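/- Let $K$ be a field and let $H=(H^0,H^1,s,r)$ be a directed hypergraph: $H^0$ (vertices) and $H^1$ (hyperedges) are sets, and $s,r$ assign to every $h\in H^1$ nonempty finite multisets $s(h)=\{s(h)_1,\dots,s(h)_{|s(h)|}\}$ and $r(h)=\{r(h)_1,\dots,r(h)_{|r(h)|}\}$ of vertices, whose elements (with multiplicity) are ordered in an arbitrary fixed way. Let $K\langle X\rangle$ be the free nonunital associative $K$-algebra on $X=\{v,h_{ij},h_{ij}^*\mid v\in H^0,\ h\in H^1,\ 1\le i\le|s(h)|,\ 1\le j\le |r(h)|\}$; the nonempty words over $X$ form a $K$-basis of it. The Leavitt path algebra $L_K(H)$ is the quotient of $K\langle X\rangle$ by the relations (i) $uv=\delta_{uv}u$ for $u,v\in H^0$; (ii) $s(h)_ih_{ij}=h_{ij}=h_{ij}r(h)_j$ and $r(h)_jh_{ij}^*=h_{ij}^*=h_{ij}^*s(h)_i$; (iii) $\sum_{k=1}^{|r(h)|}h_{ik}h_{jk}^*=\delta_{ij}s(h)_i$ for $1\le i,j\le|s(h)|$; (iv) $\sum_{k=1}^{|s(h)|}h_{ki}^*h_{kj}=\delta_{ij}r(h)_i$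 for $1\le i,j\le|r(h)|$ (for all $h\in H^1$). Regard $h_{ij}$ as an edge from $s(h)_i$ to $r(h)_j$ and $h_{ij}^*$ as an edge from $r(h)_j$ to $s(h)_i$. A d-path is either a single vertex (of length $0$) or a nonempty word $x_1\cdots x_n$ in these edges such that the range of $x_t$ is the source of $x_{t+1}$ for $1\le t<n$ (of length $n$). A nod-path is a d-path that contains no subword of the form $h_{i1}h_{j1}^*$ or $h_{1i}^*h_{1j}$. A ring with enough idempotents is a pair $(R,E)$ where $R$ is a (not necessarily unital) associative ring and $E$ is a set of nonzero pairwise orthogonal idempotents of $R$ such that for every finite $S\subseteq R$ there is a finite sum $e$ of distinct elements of $E$ with $exe=x$ for all $x\in S$. A local valuation on $(R,E)$ is a map $\nu:R\to\mathbb N_0\cup\{-\infty\}$ such that $\nu(x)=-\infty$ if and only if $x=0$; $\nu(x-y)\le\max\{\nu(x),\nu(y)\}$ for all $x,y\in R$; and $\nu(xy)=\nu(x)+\nu(y)$ whenever $e\in E$, $x\in Re$ and $y\in eR$ (with the conventions $-\infty<n$ for $n\in\mathbb N_0$ and $(-\infty)+n=n+(-\infty)=-\infty$ for $n\in\mathbb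 N_0\cup\{-\infty\}$). **Theorem.** Suppose that $|s(h)|\ge2$ and $|r(h)|\ge 2$ (counted with multiplicity) for every $h\in H^1$. Then every $a\in L_K(H)$ has exactly one representative $\operatorname{NF}(a)\in K\langle X\rangle$ that is a $K$-linear combination of nod-paths; let $\operatorname{supp}(a)$ be the set of nod-paths that occur in $\operatorname{NF}(a)$ with nonzero coefficient. Moreover, distinct vertices have distinct images in $L_K(H)$, the pair $(L_K(H),H^0)$ is a ring with enough idempotents, and the map $$\nu:L_K(H)\to\mathbb N_0\cup\{-\infty\},\qquad a\mapsto\max\{|p| : p\in\operatorname{supp}(a)\}\qquad(\max\emptyset=-\infty),$$ where $|p|$ denotes the length of $p$, is a local valuation on $(L_K(H),H^0)$. -/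

import Mathlib

universe u v w

/-- A directed hypergraph with set of vertices `V` and set of hyperedges `E`. The source and the
range of a hyperedge are nonempty finite multisets of vertices. -/
structure DirectedHypergraph (V : Type u) (E : Type v) where
  source : E → Multiset V
  range : E → Multiset V
  source_ne_zero : ∀ h, source h ≠ 0
  range_ne_zero : ∀ h, range h ≠ 0

namespace DirectedHypergraph

variable {V : Type u} {E : Type v}

/-- The number `|s(h)|`, counted with multiplicity. -/
abbrev sourceCard (H : DirectedHypergraph V E) (h : E) : ℕ := (H.source h).card

/-- The number `|r(h)|`, counted with multiplicity. -/
abbrev rangeCard (H : DirectedHypergraph V E) (h : E) : ℕ := (H.range h).card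

/-- Condition (LV): all sources and ranges have at least two elements, with multiplicity. -/
def ConditionLV (H : DirectedHypergraph V E) : Prop :=
  ∀ h, 2 ≤ H.sourceCard h ∧ 2 ≤ H.rangeCard h

/-- A choice of orderings `s(h) = {s(h)_1, …, s(h)_m}` and `r(h) = {r(h)_1, …, r(h)_n}` for all
hyperedges `h`. The indices are shifted by one, so that the first element has index `0`. -/
structure Enumeration (H : DirectedHypergraph V E) where
  src : (h : E) → Fin (H.sourceCard h) → V
  rng : (h : E) → Fin (H.rangeCard h) → V
  map_src : ∀ h, Finset.univ.val.map (src h) = H.source h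
  map_rng : ∀ h, Finset.univ.val.map (rng h) = H.range h

/-- The letters `v`, `h_{ij}` and `h_{ij}^*`. Here `ghost h i j` is `h_{ij}^*`, so that the index
`i` always refers to `s(h)` and the index `j` to `r(h)`. -/
inductive Letter (H : DirectedHypergraph V E) : Type (max u v)
  | vert (x : V) : Letter H
  | edge (h : E) (i : Fin (H.sourceCard h)) (j : Fin (H.rangeCard h)) : Letter H
  | ghost (h : E) (i : Fin (H.sourceCard h)) (j : Fin (H.rangeCard h)) : Letter H

/-- The letter is a vertex. -/
def Letter.IsVertex {H : DirectedHypergraph V E} : H.Letter → Prop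
  | .vert _ => True
  | .edge _ _ _ => False
  | .ghost _ _ _ => False

/-- The nonempty words over the alphabet of letters. -/
abbrev Word (H : DirectedHypergraph V E) : Type (max u v) := FreeSemigroup H.Letter

/-- The list of letters of a word. -/
def Word.letters {H : DirectedHypergraph V E} (p : H.Word) : List H.Letter := p.head :: p.tail

/-- The free (nonunital, associative) `K`-algebra generated by the letters: the `K`-vector space
with basis the nonempty words, with the juxtaposition of words as multiplication. -/
abbrev FreeAlg (K : Type w) [Field K] (H : DirectedHypergraph V E) : Type (max u v w) :=
  MonoidAlgebra K H.Word

/-- A letter as an element of the free algebra. -/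
noncomputable def Letter.toFree (K : Type w) [Field K] {H : DirectedHypergraph V E} (x : H.Letter) :
    FreeAlg K H :=
  MonoidAlgebra.single (FreeSemigroup.of x) 1

namespace Enumeration

variable {H : DirectedHypergraph V E}

open scoped Classical in
/-- The defining relations of the Leavitt path algebra of a hypergraph. -/
inductive Rel (K : Type w) [Field K] (o : H.Enumeration) : FreeAlg K H → FreeAlg K H → Prop
  | vert_mul_vert (x y : V) :
      Rel K o ((Letter.vert x).toFree K * (Letter.vert y).toFree K)
        (if x = y then (Letter.vert x).toFree K else 0)
  | src_mul_edge (h : E) (i : Fin (H.sourceCard h)) (j : Fin (H.rangeCard h)) :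
      Rel K o ((Letter.vert (o.src h i)).toFree K * (Letter.edge h i j).toFree K)
        ((Letter.edge h i j).toFree K)
  | edge_mul_rng (h : E) (i : Fin (H.sourceCard h)) (j : Fin (H.rangeCard h)) :
      Rel K o ((Letter.edge h i j).toFree K * (Letter.vert (o.rng h j)).toFree K)
        ((Letter.edge h i j).toFree K)
  | rng_mul_ghost (h : E) (i : Fin (H.sourceCard h)) (j : Fin (H.rangeCard h)) :
      Rel K o ((Letter.vert (o.rng h j)).toFree K * (Letter.ghost h i j).toFree K)
        ((Letter.ghost h i j).toFree K)
  | ghost_mul_src (h : E) (i : Fin (H.sourceCard h)) (j : Fin (H.rangeCard h)) :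
      Rel K o ((Letter.ghost h i j).toFree K * (Letter.vert (o.src h i)).toFree K)
        ((Letter.ghost h i j).toFree K)
  | sum_edge_ghost (h : E) (i j : Fin (H.sourceCard h)) :
      Rel K o (∑ k : Fin (H.rangeCard h),
          (Letter.edge h i k).toFree K * (Letter.ghost h j k).toFree K)
        (if i = j then (Letter.vert (o.src h i)).toFree K else 0)
  | sum_ghost_edge (h : E) (i j : Fin (H.rangeCard h)) :
      Rel K o (∑ k : Fin (H.sourceCard h),
          (Letter.ghost h k i).toFree K * (Letter.edge h k j).toFree K)
        (if i = j then (Letter.vert (o.rng h i)).toFree K else 0)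

/-- The (two-sided, `K`-linear) ideal of the free algebra generated by the defining relations. -/
noncomputable def relIdeal (K : Type w) [Field K] (o : H.Enumeration) : Submodule K (FreeAlg K H) :=
  sInf {I | (∀ a b, Rel K o a b → a - b ∈ I) ∧ ∀ a, ∀ x ∈ I, a * x ∈ I ∧ x * a ∈ I}

theorem rel_sub_mem (K : Type w) [Field K] (o : H.Enumeration) {a b : FreeAlg K H}
    (hab : Rel K o a b) : a - b ∈ o.relIdeal K := by
  rw [relIdeal, Submodule.mem_sInf]
  exact fun I hI => hI.1 a b hab

theorem mul_mem_left (K : Type w) [Field K] (o : H.Enumeration) (a : FreeAlg K H)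
    {x : FreeAlg K H} (hx : x ∈ o.relIdeal K) : a * x ∈ o.relIdeal K := by
  rw [relIdeal, Submodule.mem_sInf] at hx ⊢
  exact fun I hI => (hI.2 a x (hx I hI)).1

theorem mul_mem_right (K : Type w) [Field K] (o : H.Enumeration) (a : FreeAlg K H)
    {x : FreeAlg K H} (hx : x ∈ o.relIdeal K) : x * a ∈ o.relIdeal K := by
  rw [relIdeal, Submodule.mem_sInf] at hx ⊢
  exact fun I hI => (hI.2 a x (hx I hI)).2

end Enumeration

/-- The Leavitt path algebra `L_K(H)` of a hypergraph (with chosen orderings of the sources and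
ranges): the quotient of the free algebra by the ideal generated by the defining relations. -/
def LeavittPathAlgebra (K : Type w) [Field K] {H : DirectedHypergraph V E} (o : H.Enumeration) :
    Type (max u v w) :=
  FreeAlg K H ⧸ o.relIdeal K

namespace LeavittPathAlgebra

variable (K : Type w) [Field K] {H : DirectedHypergraph V E} (o : H.Enumeration)

noncomputable instance instAddCommGroup : AddCommGroup (LeavittPathAlgebra K o) :=
  inferInstanceAs (AddCommGroup (FreeAlg K H ⧸ o.relIdeal K))

noncomputable instance instModule : Module K (LeavittPathAlgebra K o) :=
  inferInstanceAs (Module K (FreeAlg K H ⧸ o.relIdeal K))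

/-- The canonical projection from the free algebra. -/
noncomputable def mk : FreeAlg K H →ₗ[K] LeavittPathAlgebra K o := (o.relIdeal K).mkQ

theorem mk_surjective : Function.Surjective (mk K o) := Submodule.mkQ_surjective _

theorem mk_eq_mk_iff (a b : FreeAlg K H) : mk K o a = mk K o b ↔ a - b ∈ o.relIdeal K :=
  Submodule.Quotient.eq (o.relIdeal K)

/-- The multiplication induced by that of the free algebra. -/
noncomputable instance instMul : Mul (LeavittPathAlgebra K o) where
  mul := Quotient.map₂ (· * ·) (by
    intro a a' ha b b' hb
    have h1 : a - a' ∈ o.relIdeal K := (Submodule.quotientRel_def _).1 ha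
    have h2 : b - b' ∈ o.relIdeal K := (Submodule.quotientRel_def _).1 hb
    refine (Submodule.quotientRel_def _).2 ?_
    have h3 : a * b - a' * b' = (a - a') * b + a' * (b - b') := by
      rw [sub_mul, mul_sub]; abel
    change a * b - a' * b' ∈ o.relIdeal K
    rw [h3]
    exact Submodule.add_mem _ (o.mul_mem_right K b h1) (o.mul_mem_left K a' h2))

theorem mk_mul (a b : FreeAlg K H) : mk K o (a * b) = mk K o a * mk K o b := rfl

noncomputable instance instNonUnitalRing : NonUnitalRing (LeavittPathAlgebra K o) where
  __ := instAddCommGroup K o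
  __ := instMul K o
  left_distrib x y z := by
    obtain ⟨a, rfl⟩ := mk_surjective K o x
    obtain ⟨b, rfl⟩ := mk_surjective K o y
    obtain ⟨c, rfl⟩ := mk_surjective K o z
    rw [← map_add, ← mk_mul, ← mk_mul, ← mk_mul, ← map_add, mul_add]
  right_distrib x y z := by
    obtain ⟨a, rfl⟩ := mk_surjective K o x
    obtain ⟨b, rfl⟩ := mk_surjective K o y
    obtain ⟨c, rfl⟩ := mk_surjective K o z
    rw [← map_add, ← mk_mul, ← mk_mul, ← mk_mul, ← map_add, add_mul]
  zero_mul x := by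
    obtain ⟨a, rfl⟩ := mk_surjective K o x
    rw [← map_zero (mk K o), ← mk_mul, zero_mul]
  mul_zero x := by
    obtain ⟨a, rfl⟩ := mk_surjective K o x
    rw [← map_zero (mk K o), ← mk_mul, mul_zero]
  mul_assoc x y z := by
    obtain ⟨a, rfl⟩ := mk_surjective K o x
    obtain ⟨b, rfl⟩ := mk_surjective K o y
    obtain ⟨c, rfl⟩ := mk_surjective K o z
    rw [← mk_mul, ← mk_mul, ← mk_mul, ← mk_mul, mul_assoc]

instance instIsScalarTower : IsScalarTower K (LeavittPathAlgebra K o) (LeavittPathAlgebra K o) where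
  smul_assoc k x y := by
    obtain ⟨a, rfl⟩ := mk_surjective K o x
    obtain ⟨b, rfl⟩ := mk_surjective K o y
    simp only [smul_eq_mul]
    rw [← map_smul, ← mk_mul, ← mk_mul, ← map_smul, smul_mul_assoc]

instance instSMulCommClass : SMulCommClass K (LeavittPathAlgebra K o) (LeavittPathAlgebra K o) where
  smul_comm k x y := by
    obtain ⟨a, rfl⟩ := mk_surjective K o x
    obtain ⟨b, rfl⟩ := mk_surjective K o y
    simp only [smul_eq_mul]
    rw [← map_smul, ← mk_mul, ← mk_mul, ← map_smul, mul_smul_comm]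

/-- The vertices, as a subset of `L_K(H)`. -/
def vertexSet : Set (LeavittPathAlgebra K o) :=
  Set.range fun x : V => mk K o ((Letter.vert x).toFree K)

end LeavittPathAlgebra

namespace Enumeration

variable {H : DirectedHypergraph V E}

/-- The source of a letter in the double graph of the directed graph associated to `H`. -/
def letterSource (o : H.Enumeration) : H.Letter → V
  | .vert x => x
  | .edge h i _ => o.src h i
  | .ghost h _ j => o.rng h j

/-- The range of a letter in the double graph of the directed graph associated to `H`. -/
def letterRange (o : H.Enumeration) : H.Letter → V
  | .vert x => x
  | .edge h _ j => o.rng h j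
  | .ghost h i _ => o.src h i

/-- A d-path is a path in the double graph: a single vertex, or a nonempty word in the letters
`h_{ij}`, `h_{ij}^*` in which the range of each letter is the source of the next one. -/
def IsDPath (o : H.Enumeration) (p : H.Word) : Prop :=
  (∃ x, p = FreeSemigroup.of (Letter.vert x)) ∨
    ((∀ x ∈ p.letters, ¬ x.IsVertex) ∧
      p.letters.IsChain fun x y => o.letterRange x = o.letterSource y)

end Enumeration

/-- The forbidden words `h_{i1} h_{j1}^*` and `h_{1i}^* h_{1j}`. -/
inductive Forbidden (H : DirectedHypergraph V E) : H.Word → Prop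
  | edge_ghost (h : E) (i j : Fin (H.sourceCard h)) (k : Fin (H.rangeCard h)) (hk : k.val = 0) :
      Forbidden H (FreeSemigroup.of (Letter.edge h i k) * FreeSemigroup.of (Letter.ghost h j k))
  | ghost_edge (h : E) (i j : Fin (H.rangeCard h)) (k : Fin (H.sourceCard h)) (hk : k.val = 0) :
      Forbidden H (FreeSemigroup.of (Letter.ghost h k i) * FreeSemigroup.of (Letter.edge h k j))

/-- The length of a d-path: `0` for a vertex, the number of letters otherwise. -/
def pathLength {H : DirectedHypergraph V E} : H.Word → ℕ
  | ⟨.vert _, []⟩ => 0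
  | p => p.length

namespace Enumeration

variable {H : DirectedHypergraph V E}

/-- A nod-path (normal d-path) is a d-path none of whose subwords is forbidden. -/
def IsNodPath (o : H.Enumeration) (p : H.Word) : Prop :=
  o.IsDPath p ∧ ∀ q : H.Word, H.Forbidden q → ¬ q.letters <:+: p.letters

/-- The linear span of the nod-paths in the free algebra. Its elements are called normal. -/
noncomputable def nodSpan (K : Type w) [Field K] (o : H.Enumeration) : Submodule K (FreeAlg K H) :=
  Submodule.span K {f | ∃ p : H.Word, o.IsNodPath p ∧ f = MonoidAlgebra.single p 1}

end Enumeration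

namespace LeavittPathAlgebra

variable (K : Type w) [Field K] {H : DirectedHypergraph V E} (o : H.Enumeration)

/-- `f` is a normal representative of `a`. -/
def IsNormalRep (a : LeavittPathAlgebra K o) (f : FreeAlg K H) : Prop :=
  f ∈ o.nodSpan K ∧ mk K o f = a

open scoped Classical in
/-- The normal representative `NF(a)` of `a`. -/
noncomputable def normalForm (a : LeavittPathAlgebra K o) : FreeAlg K H :=
  if h : ∃ f, IsNormalRep K o a f then h.choose else 0

/-- The support of `a`: the set of all nod-paths with nonzero coefficient in `NF(a)`. -/
noncomputable def supp (a : LeavittPathAlgebra K o) : Finset H.Word :=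
  (normalForm K o a).coeff.support

/-- The maximal length of an element of the support of `a`, where the maximum of the empty set is
`-∞`, written as `⊥`. -/
noncomputable def maxLength (a : LeavittPathAlgebra K o) : WithBot ℕ :=
  (supp K o a).sup fun p => (pathLength p : WithBot ℕ)

end LeavittPathAlgebra

end DirectedHypergraph

/-- `U` is a set of local units for the (not necessarily unital) ring `R`. -/
structure IsSetOfLocalUnits {R : Type u} [NonUnitalRing R] (U : Set R) : Prop where
  idem : ∀ e ∈ U, e * e = e
  exists_unit : ∀ S : Finset R, ∃ e ∈ U, ∀ x ∈ S, e * x * e = x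

/-- `(R, E)` is a ring with enough idempotents: `E` is a set of nonzero orthogonal idempotents of
`R` such that the finite sums of distinct elements of `E` form a set of local units. -/
structure IsRingWithEnoughIdempotents {R : Type u} [NonUnitalRing R] (E : Set R) : Prop where
  ne_zero : ∀ e ∈ E, e ≠ 0
  idem : ∀ e ∈ E, e * e = e
  orthogonal : ∀ e ∈ E, ∀ f ∈ E, e ≠ f → e * f = 0
  localUnits : IsSetOfLocalUnits {e : R | ∃ F : Finset R, (F : Set R) ⊆ E ∧ e = ∑ f ∈ F, f}

/-- A local valuation on a ring with enough idempotents `(R, E)`. The value `-∞` is `⊥`. -/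
structure IsLocalValuation {R : Type u} [NonUnitalRing R] (E : Set R) (ν : R → WithBot ℕ) :
    Prop where
  enoughIdempotents : IsRingWithEnoughIdempotents E
  eq_bot_iff : ∀ x, ν x = ⊥ ↔ x = 0
  map_sub_le : ∀ x y, ν (x - y) ≤ max (ν x) (ν y)
  map_mul : ∀ e ∈ E, ∀ x ∈ Set.range (fun a : R => a * e), ∀ y ∈ Set.range (fun b : R => e * b),
    ν (x * y) = ν x + ν y

/-! Solve (iii) and (iv) for the term whose summation index is the first one (0 in the code). This
gives rewriting rules whose irreducible d-paths are exactly the nod-paths. Uniqueness of normal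
forms comes from a representation instead of a confluence argument. The space with basis the
nod-paths (`normalSpace`) carries operators for all letters: prepending a letter to a nod-path takes
at most one rewriting step (`act_mem_normalSpace`). These operators satisfy the defining relations;
the essential case is `sum_act_act`, where two rules overlap. Hence the relation ideal acts by zero
(`freeAct_eq_zero`), while acting on the vertices recovers each combination of nod-paths
(`freeAct_pathFree`), so nod-paths are linearly independent in the quotient. They span it by
`exists_ofPaths_eq`. For the valuation only words of maximal length matter. Let all paths of a end
at e and all paths of b start at e, and let sx and yt be longest paths in their supports. If x and y
do not occur together in a relation (iii) or (iv), the coefficient of sxyt in ab is a(sx)b(yt),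
which is nonzero. Otherwise let x_k, y_k arise from x, y by changing their common index to k, and
put α_k = a(s x_k), β_k = b(y_k t). If ab had no term of top length, `pathMul_apply` would force α_k
β_l = 0 for k ≠ l and α_k β_k = α_0 β_0 for all k. The matrix (α_k β_l), of rank at most one, would
then be a nonzero scalar matrix, which is impossible as its size |r(h)| or |s(h)| is at least 2
(`exists_pathMul_apply_ne_zero`). -/

namespace DirectedHypergraph

/-! ### Arcs, treating edges and ghost edges alike, and normal paths -/

/-- A numerical description of the two sides of each hyperedge: side `true` of `h` is its source,
side `false` its range. -/
structure Sides (V : Type u) (E : Type v) where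
  dim : E → Bool → ℕ
  vtx : E → Bool → ℕ → V

/-- The arc from the vertex number `row` on the given side of `hyp` to the vertex number `col` on
the opposite side. -/
@[ext]
structure Arc (E : Type v) where
  hyp : E
  side : Bool
  row : ℕ
  col : ℕ

/-- The two-letter word `x y` is forbidden. -/
def Arc.Collapses {E : Type v} (x y : Arc E) : Prop :=
  y.hyp = x.hyp ∧ y.side = !x.side ∧ x.col = 0 ∧ y.row = 0

namespace Sides

variable {V : Type u} {E : Type v} (G : Sides V E)

def src (x : Arc E) : V := G.vtx x.hyp x.side x.row

def tgt (x : Arc E) : V := G.vtx x.hyp (!x.side) x.col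

/-- The arc has indices within the bounds. -/
def InRange (x : Arc E) : Prop := x.row < G.dim x.hyp x.side ∧ x.col < G.dim x.hyp (!x.side)

/-- The initial vertex of the path with the given list of arcs and the given final vertex. -/
def start : List (Arc E) → V → V
  | [], v => v
  | x :: _, _ => G.src x

/-- The arc `x` can be prepended to `l` without creating a forbidden subword. -/
def Free (x : Arc E) (l : List (Arc E)) : Prop := ∀ y ∈ l.head?, ¬ x.Collapses y

/-- A list of arcs forms a path without forbidden subwords that ends at the given vertex. -/
def IsNormal : List (Arc E) → V → Prop
  | [], _ => True
  | x :: l, v => G.InRange x ∧ G.tgt x = G.start l v ∧ Free x l ∧ IsNormal l v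

theorem IsNormal.append_right {s t : List (Arc E)} {v : V} (h : G.IsNormal (s ++ t) v) :
    G.IsNormal t v := by
  induction s with
  | nil => exact h
  | cons x s ih => exact ih h.2.2.2

/-- The row of `x` plays no role here. This is why a rewriting step at the front of a path creates
no forbidden word further to the right. -/
theorem free_congr {x x' : Arc E} (hh : x.hyp = x'.hyp) (hs : x.side = x'.side)
    (hc : x.col = x'.col) (l : List (Arc E)) : Free x l ↔ Free x' l := by
  simp only [Free, Arc.Collapses, hh, hs, hc]

theorem free_cons_congr {x y y' : Arc E} (hh : y.hyp = y'.hyp) (hs : y.side = y'.side)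
    (hr : y.row = y'.row) (l l' : List (Arc E)) : Free x (y :: l) ↔ Free x (y' :: l') := by
  simp [Free, Arc.Collapses, hh, hs, hr]

theorem free_cons {x y : Arc E} {l : List (Arc E)} : Free x (y :: l) ↔ ¬ x.Collapses y := by
  simp [Free]

theorem free_nil (x : Arc E) : Free x [] := by simp [Free]

/-- A path, given by its list of arcs and its final vertex. -/
abbrev ArcPath (V : Type u) (E : Type v) := List (Arc E) × V

variable (K : Type w) [Field K]

/-- The vector space with basis the paths. -/
abbrev PathSpace (V : Type u) (E : Type v) := ArcPath V E →₀ K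

/-- The subspace of normal elements. -/
def normalSpace : Submodule K (PathSpace K V E) :=
  Finsupp.supported K K {q | G.IsNormal q.1 q.2}

theorem single_mem_normalSpace {q : ArcPath V E} (hq : G.IsNormal q.1 q.2) (c : K) :
    Finsupp.single q c ∈ G.normalSpace K :=
  Finsupp.single_mem_supported K c hq

@[elab_as_elim]
theorem normalSpace_induction {motive : (m : PathSpace K V E) → m ∈ G.normalSpace K → Prop}
    (single : ∀ l v (h : G.IsNormal l v),
      motive (Finsupp.single (l, v) 1) (G.single_mem_normalSpace K h 1))
    (zero : motive 0 (zero_mem _))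
    (add : ∀ m n hm hn, motive m hm → motive n hn → motive (m + n) (add_mem hm hn))
    (smul : ∀ (c : K) m hm, motive m hm → motive (c • m) (Submodule.smul_mem _ c hm))
    {m : PathSpace K V E} (hm : m ∈ G.normalSpace K) : motive m hm := by
  have hspan : G.normalSpace K = Submodule.span K ((fun q => Finsupp.single q 1) ''
      {q : ArcPath V E | G.IsNormal q.1 q.2}) := Finsupp.supported_eq_span_single K _
  have key : ∀ m ∈ Submodule.span K ((fun q => Finsupp.single q (1 : K)) ''
      {q : ArcPath V E | G.IsNormal q.1 q.2}), ∃ hm : m ∈ G.normalSpace K, motive m hm := by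
    intro m hm
    induction hm using Submodule.span_induction with
    | mem x hx => obtain ⟨q, hq, rfl⟩ := hx; exact ⟨_, single _ _ hq⟩
    | zero => exact ⟨_, zero⟩
    | add x y _ _ h1 h2 => exact ⟨_, add _ _ _ _ h1.2 h2.2⟩
    | smul c x _ h => exact ⟨_, smul _ _ _ h.2⟩
  exact (key m (hspan ▸ hm)).2

/-! ### Left multiplication by arcs and vertices on normal paths -/

open scoped Classical in
/-- The normal form of the arc `x` times a path starting at the range of `x`. -/
noncomputable def prepend (x : Arc E) (v : V) : List (Arc E) → PathSpace K V E
  | [] => Finsupp.single ([x], v) 1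
  | y :: t =>
    if x.Collapses y then
      (if y.col = x.row then Finsupp.single (t, v) 1 else 0) -
        ∑ k ∈ Finset.Ico 1 (G.dim x.hyp (!x.side)),
          Finsupp.single (⟨x.hyp, x.side, x.row, k⟩ :: ⟨x.hyp, !x.side, k, y.col⟩ :: t, v) 1
    else Finsupp.single (x :: y :: t, v) 1

open scoped Classical in
/-- The left multiplication by the arc `x` on the space of paths. -/
noncomputable def act (x : Arc E) : PathSpace K V E →ₗ[K] PathSpace K V E :=
  Finsupp.linearCombination K fun q =>
    if G.tgt x = G.start q.1 q.2 then G.prepend K x q.2 q.1 else 0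

open scoped Classical in
/-- The left multiplication by the vertex `u` on the space of paths. -/
noncomputable def vact (u : V) : PathSpace K V E →ₗ[K] PathSpace K V E :=
  Finsupp.linearCombination K fun q => if G.start q.1 q.2 = u then Finsupp.single q 1 else 0

variable {K}

open scoped Classical in
theorem vact_single (u : V) (l : List (Arc E)) (v : V) :
    G.vact K u (Finsupp.single (l, v) 1) =
      if G.start l v = u then Finsupp.single (l, v) 1 else 0 := by
  simp [vact]

theorem act_single_of_ne {x : Arc E} {l : List (Arc E)} {v : V} (h : G.tgt x ≠ G.start l v) :
    G.act K x (Finsupp.single (l, v) 1) = 0 := by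
  simp [act, h]

theorem act_single_of_free {x : Arc E} {l : List (Arc E)} {v : V} (h : G.tgt x = G.start l v)
    (hf : Free x l) : G.act K x (Finsupp.single (l, v) 1) = Finsupp.single (x :: l, v) 1 := by
  cases l with
  | nil => simp [act, h, prepend]
  | cons y t => simp [act, h, prepend, free_cons.1 hf]

open scoped Classical in
-- Composability need not be assumed: both middle indices are 0 on the same side of the same
-- hyperedge, so the vertices agree.
theorem act_single_of_collapses {x y : Arc E} {t : List (Arc E)} {v : V} (hc : x.Collapses y) :
    G.act K x (Finsupp.single (y :: t, v) 1) =
      (if y.col = x.row then Finsupp.single (t, v) 1 else 0) -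
        ∑ k ∈ Finset.Ico 1 (G.dim x.hyp (!x.side)),
          Finsupp.single (⟨x.hyp, x.side, x.row, k⟩ :: ⟨x.hyp, !x.side, k, y.col⟩ :: t, v) 1 := by
  have h : G.tgt x = G.start (y :: t) v := by
    obtain ⟨h1, h2, h3, h4⟩ := hc
    simp [tgt, start, src, h1, h2, h3, h4]
  simp [act, h, prepend, hc]

/-- A single rewriting step suffices: the new pairs have middle index `k ≥ 1`, so they are not
forbidden, and the second new arc has the same column as `y`, so it stays free in front of `t`. -/
theorem act_mem_normalSpace {x : Arc E} (hx : G.InRange x) {m : PathSpace K V E}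
    (hm : m ∈ G.normalSpace K) : G.act K x m ∈ G.normalSpace K := by
  induction hm using normalSpace_induction with
  | zero => simp
  | add m n _ _ h1 h2 => rw [map_add]; exact add_mem h1 h2
  | smul c m _ h => rw [map_smul]; exact Submodule.smul_mem _ _ h
  | single l v hl =>
    by_cases h : G.tgt x = G.start l v
    · by_cases hf : Free x l
      · rw [G.act_single_of_free h hf]
        exact G.single_mem_normalSpace K (q := (x :: l, v)) ⟨hx, h, hf, hl⟩ _
      · cases l with
        | nil => exact absurd (free_nil x) hf
        | cons y t =>
          rw [free_cons, not_not] at hf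
          obtain ⟨hy, hyt, hft, ht⟩ := hl
          rw [G.act_single_of_collapses hf]
          obtain ⟨h1, h2, h3, h4⟩ := hf
          refine sub_mem ?_ (sum_mem fun k hk => G.single_mem_normalSpace K ?_ _)
          · split_ifs
            exacts [G.single_mem_normalSpace K ht _, zero_mem _]
          · rw [Finset.mem_Ico] at hk
            refine ⟨⟨hx.1, hk.2⟩, rfl, ?_, ⟨hk.2, ?_⟩, ?_, ?_, ht⟩
            · rw [free_cons]; rintro ⟨-, -, h, -⟩; simp at h; omega
            · simpa [InRange, h1, h2] using hy.2
            · rw [← hyt]; simp [tgt, h1, h2]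
            · exact (free_congr (x' := ⟨x.hyp, !x.side, k, y.col⟩) h1 h2 rfl t).1 hft
    · rw [G.act_single_of_ne h]; exact zero_mem _

theorem vact_mem_normalSpace (u : V) {m : PathSpace K V E}
    (hm : m ∈ G.normalSpace K) : G.vact K u m ∈ G.normalSpace K := by
  classical
  induction hm using normalSpace_induction with
  | zero => simp
  | add m n _ _ h1 h2 => rw [map_add]; exact add_mem h1 h2
  | smul c m _ h => rw [map_smul]; exact Submodule.smul_mem _ _ h
  | single l v hl =>
    rw [vact_single]
    split_ifs
    exacts [G.single_mem_normalSpace K hl _, zero_mem _]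

open scoped Classical in
-- Only the term `k = 0` is rewritten, and its correction sum cancels against the remaining terms,
-- which need no rewriting.
theorem sum_act_single_cons (h : E) (b : Bool) (hd : 0 < G.dim h (!b)) (i j : ℕ)
    (t : List (Arc E)) (v : V) :
    ∑ k ∈ Finset.range (G.dim h (!b)),
        G.act K ⟨h, b, i, k⟩ (Finsupp.single (⟨h, !b, k, j⟩ :: t, v) 1) =
      if j = i then Finsupp.single (t, v) 1 else 0 := by
  rw [Finset.range_eq_Ico, Finset.sum_eq_sum_Ico_succ_bot hd,
    G.act_single_of_collapses (x := ⟨h, b, i, 0⟩) (y := ⟨h, !b, 0, j⟩) ⟨rfl, rfl, rfl, rfl⟩]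
  rw [zero_add, sub_add_eq_add_sub, sub_eq_iff_eq_add, add_right_inj]
  refine Finset.sum_congr rfl fun k hk => G.act_single_of_free rfl ?_
  rw [free_cons]
  rintro ⟨-, -, h, -⟩
  rw [Finset.mem_Ico] at hk
  simp at h
  omega

open scoped Classical in
-- Relations (iii) and (iv) at once, for `b = true` and `b = false`. The difficulty is the overlap
-- in which the inner arc already collapses with the first arc of the path.
theorem sum_act_act (h : E) (b : Bool) (hd : 0 < G.dim h (!b)) {i j : ℕ}
    (hi : i < G.dim h b) {m : PathSpace K V E} (hm : m ∈ G.normalSpace K) :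
    ∑ k ∈ Finset.range (G.dim h (!b)), G.act K ⟨h, b, i, k⟩ (G.act K ⟨h, !b, k, j⟩ m) =
      if i = j then G.vact K (G.vtx h b i) m else 0 := by
  induction hm using normalSpace_induction with
  | zero => simp
  | add m n _ _ h1 h2 =>
    simp only [map_add, Finset.sum_add_distrib, h1, h2]
    split_ifs <;> simp
  | smul c m _ h => simp only [map_smul, ← Finset.smul_sum, h, smul_ite, smul_zero]
  | single l v hl =>
    by_cases hs : G.vtx h b j = G.start l v
    · have htgt : ∀ k, G.tgt (⟨h, !b, k, j⟩ : Arc E) = G.start l v := by simpa [tgt] using hs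
      -- Freeness does not depend on the row, so the case `k = 0` decides for all `k`
      -- simultaneously.
      by_cases hf : Free (⟨h, !b, 0, j⟩ : Arc E) l
      · simp_rw [fun k => G.act_single_of_free (K := K) (htgt k)
          ((free_congr rfl rfl rfl l).1 hf : Free ⟨h, !b, k, j⟩ l)]
        rw [G.sum_act_single_cons h b hd, vact_single]
        by_cases hij : i = j
        · subst hij; simp [hs]
        · simp [hij, Ne.symm hij]
      · cases l with
        | nil => exact absurd (free_nil _) hf
        | cons y t =>
          rw [free_cons, not_not] at hf
          obtain ⟨h', b', r, c⟩ := y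
          obtain ⟨h1, h2, h3, h4⟩ := hf
          simp only [Bool.not_not] at h1 h2 h3 h4
          subst h1 h2 h3 h4
          obtain ⟨hy, hyt, hft, ht⟩ := hl
          -- The overlap: here `j = 0` and the path begins with an arc of row 0 and column `c`.
          -- After the inner rewriting, `sum_act_single_cons` evaluates the outer sum over each
          -- correction term.
          have hc : ∀ k, (⟨h', !b', k, 0⟩ : Arc E).Collapses ⟨h', b', 0, c⟩ := fun k =>
            ⟨rfl, by simp, rfl, rfl⟩
          simp_rw [fun k => G.act_single_of_collapses (K := K) (t := t) (v := v) (hc k)]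
          simp only [Bool.not_not, map_sub, map_sum, Finset.sum_sub_distrib]
          rw [Finset.sum_comm]
          simp_rw [G.sum_act_single_cons h' b' hd]
          have hcr : c < G.dim h' (!b') := hy.2
          have hyt' : G.tgt (⟨h', b', i, c⟩ : Arc E) = G.start t v := hyt
          have hf' : Free (⟨h', b', i, c⟩ : Arc E) t := (free_congr rfl rfl rfl t).1 hft
          have e1 : ∑ k ∈ Finset.range (G.dim h' (!b')), G.act K ⟨h', b', i, k⟩
              (if c = k then Finsupp.single (t, v) 1 else 0) =
              Finsupp.single (⟨h', b', i, c⟩ :: t, v) 1 := by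
            rw [Finset.sum_eq_single c]
            · rw [if_pos rfl, G.act_single_of_free hyt' hf']
            · intro k _ hk; rw [if_neg hk.symm, map_zero]
            · intro hk; simp [hcr] at hk
          rw [e1, Finset.sum_ite_eq' (Finset.Ico 1 (G.dim h' b')) i, vact_single]
          -- What remains is the path starting with row `i`, minus the same path if `i ≥ 1`. So only
          -- `i = 0 = j` survives.
          rcases Nat.eq_zero_or_pos i with rfl | hi0
          · simp [hs]
          · rw [if_pos (Finset.mem_Ico.2 ⟨hi0, hi⟩), sub_self, if_neg (by omega)]
    · have htgt : ∀ k, G.tgt (⟨h, !b, k, j⟩ : Arc E) ≠ G.start l v := by simpa [tgt] using hs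
      simp_rw [fun k => G.act_single_of_ne (K := K) (htgt k)]
      simp only [map_zero, Finset.sum_const_zero, vact_single]
      split_ifs with h1 h2
      · subst h1; exact absurd h2.symm hs
      · rfl
      · rfl

end Sides
end DirectedHypergraph

/-! ### Coefficients of the longest words in a product -/

namespace DirectedHypergraph
namespace Sides

variable {V : Type u} {E : Type v} (G : Sides V E) {K : Type w} [Field K]

/-- The part `s` interacts with the next arc only through hyperedge, side and row, so the column of
that arc and everything after it may be exchanged. -/
theorem IsNormal.append_congr {s l l' : List (Arc E)} {x x' : Arc E} {v v' : V}
    (hh : x.hyp = x'.hyp) (hs : x.side = x'.side) (hr : x.row = x'.row)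
    (h : G.IsNormal (s ++ x :: l) v) (h' : G.IsNormal (x' :: l') v') :
    G.IsNormal (s ++ x' :: l') v' := by
  induction s with
  | nil => exact h'
  | cons z s ih =>
    obtain ⟨h1, h2, h3, h4⟩ := h
    refine ⟨h1, ?_, ?_, ih h4⟩
    · cases s with
      | nil => simpa [start, src, hh, hs, hr] using h2
      | cons => exact h2
    · cases s with
      | nil => exact (free_cons_congr hh hs hr _ _).1 h3
      | cons => exact h3

theorem tgt_of_isNormal_append {s : List (Arc E)} {x : Arc E} {v : V}
    (h : G.IsNormal (s ++ [x]) v) : G.tgt x = v :=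
  (IsNormal.append_right G h).2.1

variable (K) in
/-- The left multiplication by a list of arcs on the space of paths. -/
noncomputable def listAct : List (Arc E) → PathSpace K V E →ₗ[K] PathSpace K V E
  | [] => LinearMap.id
  | x :: l => G.act K x ∘ₗ listAct l

theorem listAct_append (s t : List (Arc E)) (m : PathSpace K V E) :
    G.listAct K (s ++ t) m = G.listAct K s (G.listAct K t m) := by
  induction s with
  | nil => rfl
  | cons x s ih => simp [listAct, ih]

theorem listAct_single_of_isNormal {s l : List (Arc E)} {v : V} (h : G.IsNormal (s ++ l) v) :
    G.listAct K s (Finsupp.single (l, v) 1) = Finsupp.single (s ++ l, v) 1 := by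
  induction s with
  | nil => rfl
  | cons x s ih =>
    obtain ⟨h1, h2, h3, h4⟩ := h
    rw [listAct, LinearMap.comp_apply, ih h4]
    exact G.act_single_of_free h2 h3

variable (V E K) in
/-- The elements all of whose paths have at most `n` arcs. -/
def lengthLE (n : ℕ) : Submodule K (PathSpace K V E) :=
  Finsupp.supported K K {q | q.1.length ≤ n}

theorem single_mem_lengthLE {n : ℕ} {q : ArcPath V E} (h : q.1.length ≤ n) :
    Finsupp.single q (1 : K) ∈ lengthLE V E K n :=
  Finsupp.single_mem_supported K 1 h

theorem apply_eq_zero_of_lengthLE {n : ℕ} {m : PathSpace K V E} (hm : m ∈ lengthLE V E K n)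
    {q : ArcPath V E} (hq : n < q.1.length) : m q = 0 := by
  by_contra h
  exact absurd ((Finsupp.mem_supported K m).1 hm (Finsupp.mem_support_iff.2 h)) (not_le.2 hq)

theorem act_mem_lengthLE (x : Arc E) {n : ℕ} {m : PathSpace K V E}
    (hm : m ∈ lengthLE V E K n) : G.act K x m ∈ lengthLE V E K (n + 1) := by
  rw [act, Finsupp.linearCombination_apply]
  refine sum_mem fun q hq => Submodule.smul_mem _ _ ?_
  have hq' : q.1.length ≤ n := (Finsupp.mem_supported K m).1 hm hq
  split_ifs
  · obtain ⟨l, v⟩ := q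
    cases l with
    | nil => exact single_mem_lengthLE (by simp)
    | cons y t =>
      simp only [List.length_cons] at hq'
      simp only [prepend]
      split_ifs
      · exact sub_mem (single_mem_lengthLE (by simp; omega))
          (sum_mem fun k _ => single_mem_lengthLE (by simp; omega))
      · exact sub_mem (zero_mem _) (sum_mem fun k _ => single_mem_lengthLE (by simp; omega))
      · exact single_mem_lengthLE (by simp; omega)
  · exact zero_mem _

theorem listAct_mem_lengthLE (s : List (Arc E)) {n : ℕ} {m : PathSpace K V E}
    (hm : m ∈ lengthLE V E K n) : G.listAct K s m ∈ lengthLE V E K (n + s.length) := by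
  induction s with
  | nil => exact hm
  | cons x s ih => exact G.act_mem_lengthLE x ih

theorem listAct_single_of_not_collapses {s t : List (Arc E)} {x y : Arc E} {e v : V}
    (hp : G.IsNormal (s ++ [x]) e) (hq : G.IsNormal (y :: t) v) (he : e = G.src y)
    (hc : ¬ x.Collapses y) :
    G.listAct K (s ++ [x]) (Finsupp.single (y :: t, v) 1) =
      Finsupp.single (s ++ x :: y :: t, v) 1 := by
  have h : G.IsNormal (s ++ x :: y :: t) v :=
    IsNormal.append_congr G rfl rfl rfl hp ⟨(IsNormal.append_right G hp).1,
      (G.tgt_of_isNormal_append hp).trans he, free_cons.2 hc, hq⟩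
  rw [G.listAct_single_of_isNormal (by simpa using h)]
  simp

open scoped Classical in
-- Further rewriting can occur only in the first term, which has at least two arcs fewer than the
-- others and so is invisible in top length.
theorem listAct_single_of_collapses {s t : List (Arc E)} {x y : Arc E} {e v : V}
    (hp : G.IsNormal (s ++ [x]) e) (hq : G.IsNormal (y :: t) v) (hc : x.Collapses y) :
    G.listAct K (s ++ [x]) (Finsupp.single (y :: t, v) 1) =
      (if y.col = x.row then G.listAct K s (Finsupp.single (t, v) 1) else 0) -
        ∑ k ∈ Finset.Ico 1 (G.dim x.hyp (!x.side)), Finsupp.single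
          (s ++ ⟨x.hyp, x.side, x.row, k⟩ :: ⟨x.hyp, !x.side, k, y.col⟩ :: t, v) 1 := by
  rw [listAct_append, listAct, listAct, LinearMap.comp_id, G.act_single_of_collapses hc, map_sub,
    map_sum]
  congr 1
  · split_ifs <;> simp
  · refine Finset.sum_congr rfl fun k hk => G.listAct_single_of_isNormal ?_
    obtain ⟨hx, hxe, -, -⟩ := IsNormal.append_right G hp
    obtain ⟨hy, hyt, hft, ht⟩ := hq
    obtain ⟨h1, h2, h3, h4⟩ := hc
    rw [Finset.mem_Ico] at hk
    refine IsNormal.append_congr G (x := x) rfl rfl rfl hp ⟨⟨hx.1, hk.2⟩, rfl, ?_, ⟨hk.2, ?_⟩, ?_, ?_, ht⟩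
    · rw [free_cons]; rintro ⟨-, -, h, -⟩; simp at h; omega
    · simpa [InRange, h1, h2] using hy.2
    · rw [← hyt]; simp [tgt, h1, h2]
    · exact (free_congr (x' := ⟨x.hyp, !x.side, k, y.col⟩) h1 h2 rfl t).1 hft

/-- The words `x y` and `x₀ y₀` occur in the same defining relation, where `x₀`, `y₀` arise from
`x`, `y` by replacing their common index by `0`. -/
def Matches (x y : Arc E) : Prop :=
  y.hyp = x.hyp ∧ y.side = (!x.side) ∧ y.row = x.col ∧ x.col < G.dim x.hyp (!x.side)

open scoped Classical in
-- In top length a word with allowed junction `x y` arises in two ways only: by plain concatenation,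
-- or as a correction term from rewriting the forbidden junction with middle index 0.
theorem listAct_single_apply {s t : List (Arc E)} {x y : Arc E} {v : V}
    (hxy : ¬ x.Collapses y) {p q : ArcPath V E} (hp : G.IsNormal p.1 p.2) (hq : G.IsNormal q.1 q.2)
    (hpq : p.2 = G.start q.1 q.2) (hps : p.1.length ≤ s.length + 1)
    (hqt : q.1.length ≤ t.length + 1) :
    G.listAct K p.1 (Finsupp.single q 1) (s ++ x :: y :: t, v) =
      (if p.1 = s ++ [x] ∧ q = (y :: t, v) then 1 else 0) -
      (if G.Matches x y ∧ p.1 = s ++ [⟨x.hyp, x.side, x.row, 0⟩] ∧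
          q = (⟨y.hyp, y.side, 0, y.col⟩ :: t, v) then 1 else 0) := by
  obtain ⟨p, e⟩ := p
  obtain ⟨q, v'⟩ := q
  rcases List.eq_nil_or_concat' p with rfl | ⟨s', x', rfl⟩
  · rw [apply_eq_zero_of_lengthLE
      (G.listAct_mem_lengthLE _ (single_mem_lengthLE (n := t.length + 1) hqt)) (by simp; omega)]
    simp
  cases q with
  | nil =>
    rw [apply_eq_zero_of_lengthLE
      (G.listAct_mem_lengthLE _ (single_mem_lengthLE (n := 0) le_rfl)) (by simp at hps ⊢; omega)]
    simp
  | cons y' t' =>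
    simp only [List.length_append, List.length_cons, List.length_nil] at hps hqt
    have key : ∀ a b : Arc E, ((s' ++ a :: b :: t', v') = (s ++ x :: y :: t, v) ↔
        s' = s ∧ a = x ∧ b = y ∧ t' = t ∧ v' = v) := by
      intro a b
      constructor
      · intro h
        rw [Prod.mk.injEq] at h
        have hl := congrArg List.length h.1
        simp at hl
        obtain ⟨h1, h2⟩ := List.append_inj h.1 (by omega)
        simp at h2
        tauto
      · rintro ⟨rfl, rfl, rfl, rfl, rfl⟩; rfl
    by_cases hc : x'.Collapses y'
    · rw [G.listAct_single_of_collapses hp hq hc]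
      have h1 : ¬ (s' ++ [x'] = s ++ [x] ∧ (y' :: t', v') = (y :: t, v)) := by
        rintro ⟨h1, h2⟩
        obtain ⟨-, h1⟩ := List.append_inj' h1 rfl
        simp only [List.cons.injEq, and_true, Prod.mk.injEq] at h1 h2
        exact hxy (h1 ▸ h2.1.1 ▸ hc)
      have h0 : (if y'.col = x'.row then G.listAct K s' (Finsupp.single (t', v') 1) else 0)
          (s ++ x :: y :: t, v) = 0 := by
        split_ifs
        · exact apply_eq_zero_of_lengthLE (G.listAct_mem_lengthLE _
            (single_mem_lengthLE (n := t'.length) le_rfl)) (by simp; omega)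
        · rfl
      rw [Finsupp.sub_apply, h0, if_neg h1, Finsupp.finsetSum_apply]
      congr 1
      simp only [Finsupp.single_apply, key]
      split_ifs with h
      all_goals
        obtain ⟨xh, xs, xr, xc⟩ := x
        obtain ⟨yh, ys, yr, yc⟩ := y
        obtain ⟨xh', xs', xr', xc'⟩ := x'
        obtain ⟨yh', ys', yr', yc'⟩ := y'
        obtain ⟨c1, c2, c3, c4⟩ := hc
        simp only at c1 c2 c3 c4
        subst c1 c2 c3 c4
        simp only [Arc.mk.injEq]
      · obtain ⟨⟨m1, m2, m3, m4⟩, h1, h2⟩ := h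
        obtain ⟨h3, h4⟩ := List.append_inj' h1 rfl
        simp only at m1 m2 m3 m4
        simp only [List.cons.injEq, and_true, Prod.mk.injEq, Arc.mk.injEq] at h4 h2
        obtain ⟨rfl, rfl, rfl, -⟩ := h4
        obtain ⟨⟨⟨-, -, -, rfl⟩, rfl⟩, rfl⟩ := h2
        subst m1 m2 m3
        rw [Finset.sum_eq_single yr]
        · simp [h3]
        · intro k _ hk; rw [if_neg]; tauto
        · intro hk
          exfalso
          apply hxy
          -- The correction sum runs over `k ≥ 1`; index 0 would make `x`, `y` collapse, against
          -- `hxy`.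
          have : yr = 0 := by
            by_contra h0; exact hk (Finset.mem_Ico.2 ⟨by omega, m4⟩)
          exact ⟨rfl, rfl, this, this⟩
      · refine Finset.sum_eq_zero fun k hk => if_neg ?_
        rintro ⟨rfl, ⟨rfl, rfl, rfl, rfl⟩, ⟨rfl, rfl, rfl, rfl⟩, rfl, rfl⟩
        exact h ⟨⟨rfl, rfl, rfl, (Finset.mem_Ico.1 hk).2⟩, rfl, rfl⟩
    · rw [G.listAct_single_of_not_collapses hp hq hpq hc, Finsupp.single_apply]
      have h2 : ¬ (G.Matches x y ∧ s' ++ [x'] = s ++ [⟨x.hyp, x.side, x.row, 0⟩] ∧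
          (y' :: t', v') = (⟨y.hyp, y.side, 0, y.col⟩ :: t, v)) := by
        rintro ⟨⟨m1, m2, -, -⟩, h1, h2⟩
        obtain ⟨-, h1⟩ := List.append_inj' h1 rfl
        simp only [List.cons.injEq, and_true, Prod.mk.injEq] at h1 h2
        apply hc
        rw [h1, h2.1.1]
        exact ⟨m1, m2, rfl, rfl⟩
      rw [if_neg h2, sub_zero]
      refine if_congr ?_ rfl rfl
      rw [key]
      constructor
      · rintro ⟨rfl, rfl, rfl, rfl, rfl⟩; exact ⟨rfl, rfl⟩
      · rintro ⟨h1, h2⟩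
        obtain ⟨h3, h4⟩ := List.append_inj' h1 rfl
        simp only [List.cons.injEq, and_true, Prod.mk.injEq] at h4 h2
        tauto

/-- The product of `a` and `b`, if all paths in `a` end where the paths in `b` start. -/
noncomputable def pathMul (a b : PathSpace K V E) : PathSpace K V E :=
  a.sum fun p c => c • G.listAct K p.1 b

/-- All paths in `a` are normal, end at `e` and have at most `n` arcs. -/
def EndsAt (e : V) (n : ℕ) (a : PathSpace K V E) : Prop :=
  ∀ p ∈ a.support, G.IsNormal p.1 p.2 ∧ p.2 = e ∧ p.1.length ≤ n

/-- All paths in `b` are normal, start at `e` and have at most `m` arcs. -/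
def StartsAt (e : V) (m : ℕ) (b : PathSpace K V E) : Prop :=
  ∀ q ∈ b.support, G.IsNormal q.1 q.2 ∧ G.start q.1 q.2 = e ∧ q.1.length ≤ m

variable {G}

open scoped Classical in
-- The bilinear extension of `listAct_single_apply`. The word itself need not be normal; only its
-- junction must be allowed.
theorem pathMul_apply {a b : PathSpace K V E} {e v : V} {s t : List (Arc E)} {x y : Arc E}
    (ha : G.EndsAt e (s.length + 1) a) (hb : G.StartsAt e (t.length + 1) b)
    (hxy : ¬ x.Collapses y) :
    G.pathMul a b (s ++ x :: y :: t, v) = a (s ++ [x], e) * b (y :: t, v) -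
      if G.Matches x y then a (s ++ [⟨x.hyp, x.side, x.row, 0⟩], e) *
        b (⟨y.hyp, y.side, 0, y.col⟩ :: t, v) else 0 := by
  have h1 : G.pathMul a b (s ++ x :: y :: t, v) = ∑ p ∈ a.support, ∑ q ∈ b.support,
      a p * (b q * G.listAct K p.1 (Finsupp.single q 1) (s ++ x :: y :: t, v)) := by
    rw [pathMul, Finsupp.sum, Finsupp.finsetSum_apply]
    refine Finset.sum_congr rfl fun p _ => ?_
    rw [Finsupp.smul_apply, smul_eq_mul, ← Finset.mul_sum]
    congr 1
    conv_lhs => rw [← Finsupp.sum_single b, Finsupp.sum, map_sum, Finsupp.finsetSum_apply]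
    refine Finset.sum_congr rfl fun q _ => ?_
    rw [← mul_one (b q), ← smul_eq_mul, ← Finsupp.smul_single, map_smul]
    simp
  have h2 : ∀ p ∈ a.support, ∀ q ∈ b.support,
      a p * (b q * G.listAct K p.1 (Finsupp.single q 1) (s ++ x :: y :: t, v)) =
      (if p = (s ++ [x], e) then a p else 0) * (if q = (y :: t, v) then b q else 0) -
      (if G.Matches x y then
        (if p = (s ++ [⟨x.hyp, x.side, x.row, 0⟩], e) then a p else 0) *
        (if q = (⟨y.hyp, y.side, 0, y.col⟩ :: t, v) then b q else 0) else 0) := by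
    intro p hp q hq
    obtain ⟨hp1, hp2, hp3⟩ := ha p hp
    obtain ⟨hq1, hq2, hq3⟩ := hb q hq
    rw [G.listAct_single_apply hxy hp1 hq1 (hp2.trans hq2.symm) hp3 hq3]
    obtain ⟨p, e'⟩ := p
    simp only at hp2
    subst hp2
    simp only [Prod.mk.injEq, and_true, mul_sub]
    congr 1
    · split_ifs <;> simp_all
    · split_ifs <;> simp_all
  rw [h1, Finset.sum_congr rfl fun p hp => Finset.sum_congr rfl (h2 p hp)]
  simp only [Finset.sum_sub_distrib]
  congr 1
  · rw [← Finset.sum_mul_sum]; simp only [Finset.sum_ite_eq', Finsupp.mem_support_iff]; split_ifs <;> simp_all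
  · split_ifs
    · rw [← Finset.sum_mul_sum]; simp only [Finset.sum_ite_eq', Finsupp.mem_support_iff]; split_ifs <;> simp_all
    · simp

end Sides
end DirectedHypergraph

/-! ### The product of two elements has a term of maximal possible length -/

namespace DirectedHypergraph
namespace Sides

variable {V : Type u} {E : Type v} {G : Sides V E} {K : Type w} [Field K]

theorem lengthLE_mono {n m : ℕ} (h : n ≤ m) : lengthLE V E K n ≤ lengthLE V E K m :=
  Finsupp.supported_mono fun _ hq => le_trans hq h

theorem pathMul_mem_lengthLE {a b : PathSpace K V E} {n m : ℕ} (ha : a ∈ lengthLE V E K n)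
    (hb : b ∈ lengthLE V E K m) : G.pathMul a b ∈ lengthLE V E K (n + m) := by
  refine sum_mem fun p hp => Submodule.smul_mem _ _ ?_
  have hp' : p.1.length ≤ n := (Finsupp.mem_supported K a).1 ha hp
  exact lengthLE_mono (by omega) (G.listAct_mem_lengthLE p.1 hb)

theorem EndsAt.mem_lengthLE {a : PathSpace K V E} {n : ℕ} {e : V} (ha : G.EndsAt e n a) :
    a ∈ lengthLE V E K n :=
  (Finsupp.mem_supported K a).2 fun p hp => (ha p hp).2.2

theorem StartsAt.mem_lengthLE {b : PathSpace K V E} {m : ℕ} {e : V} (hb : G.StartsAt e m b) :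
    b ∈ lengthLE V E K m :=
  (Finsupp.mem_supported K b).2 fun p hp => (hb p hp).2.2

/-- If all top coefficients vanished, `off` and `diag` below would make an outer product of two
vectors a nonzero scalar matrix of size at least 2. -/
theorem exists_pathMul_apply_ne_zero (hdim : ∀ h b, 2 ≤ G.dim h b) {a b : PathSpace K V E} {e : V}
    {n m : ℕ} (ha : G.EndsAt e n a) (hb : G.StartsAt e m b) {p q : ArcPath V E} (hp : p ∈ a.support)
    (hpn : p.1.length = n) (hq : q ∈ b.support) (hqm : q.1.length = m) :
    ∃ r : ArcPath V E, r.1.length = n + m ∧ G.pathMul a b r ≠ 0 := by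
  obtain ⟨p, e'⟩ := p
  obtain rfl : e' = e := (ha _ hp).2.1
  obtain ⟨q, v⟩ := q
  rcases List.eq_nil_or_concat' p with rfl | ⟨s, x, rfl⟩
  · obtain rfl : 0 = n := hpn
    have ha' : a = Finsupp.single ([], e') (a ([], e')) := by
      refine Finsupp.eq_single_iff.2 ⟨fun p hp => ?_, rfl⟩
      -- In degree 0 every path of `a` is the vertex `e'`, so `a` is a scalar multiple of it.
      obtain ⟨-, h1, h2⟩ := ha p hp
      simpa using Prod.ext (List.eq_nil_of_length_eq_zero (Nat.le_zero.1 h2)) h1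
    refine ⟨(q, v), by simpa using hqm, ?_⟩
    rw [pathMul, ha', Finsupp.sum_single_index (by simp)]
    rw [Finsupp.mem_support_iff] at hp hq
    simpa [listAct] using ⟨hp, hq⟩
  cases q with
  | nil =>
    obtain rfl : 0 = m := hqm
    have hb' : b = Finsupp.single ([], e') (b ([], e')) := by
      refine Finsupp.eq_single_iff.2 ⟨fun q hq => ?_, rfl⟩
      obtain ⟨-, h1, h2⟩ := hb q hq
      obtain ⟨l, u⟩ := q
      obtain rfl := List.eq_nil_of_length_eq_zero (Nat.le_zero.1 h2)
      simpa [start] using h1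
    obtain rfl : v = e' := (hb _ hq).2.1
    refine ⟨(s ++ [x], v), hpn, ?_⟩
    have h : G.pathMul a b = b ([], v) • a := by
      rw [pathMul]
      conv_rhs => rw [← Finsupp.sum_single a, Finsupp.smul_sum]
      refine Finsupp.sum_congr fun p hp => ?_
      obtain ⟨h1, h2, -⟩ := ha p hp
      obtain ⟨p, u⟩ := p
      obtain rfl : u = v := h2
      have h3 := G.listAct_single_of_isNormal (K := K) (s := p) (l := []) (v := u) (by simpa using h1)
      rw [List.append_nil] at h3
      rw [hb', ← mul_one (b ([], u)), ← smul_eq_mul, ← Finsupp.smul_single, map_smul, h3]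
      simp [mul_comm]
    rw [h]
    rw [Finsupp.mem_support_iff] at hp hq
    simpa using ⟨hq, hp⟩
  | cons y t =>
    obtain rfl : s.length + 1 = n := by simpa using hpn
    obtain rfl : t.length + 1 = m := by simpa using hqm
    rw [Finsupp.mem_support_iff] at hp hq
    by_contra! hcon
    classical
    have key : ∀ x' y' : Arc E, ¬ x'.Collapses y' →
        a (s ++ [x'], e') * b (y' :: t, v) = if G.Matches x' y' then
        a (s ++ [⟨x'.hyp, x'.side, x'.row, 0⟩], e') *
          b (⟨y'.hyp, y'.side, 0, y'.col⟩ :: t, v) else 0 := by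
      intro x' y' h
      have := hcon (s ++ x' :: y' :: t, v) (by simp; omega)
      rwa [pathMul_apply ha hb h, sub_eq_zero] at this
    have hxr : x.col < G.dim x.hyp (!x.side) := by
      obtain ⟨h1, -, -⟩ := ha _ (Finsupp.mem_support_iff.2 hp)
      exact (IsNormal.append_right G h1).1.2
    obtain ⟨h, c, i, k⟩ := x
    obtain ⟨h', c', k', j⟩ := y
    by_cases hm : h' = h ∧ c' = (!c) ∧ k' = k
    · obtain ⟨rfl, rfl, rfl⟩ := hm
      have off : ∀ k₁ k₂, k₁ ≠ k₂ → a (s ++ [⟨h', c, i, k₁⟩], e') = 0 ∨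
          b (⟨h', !c, k₂, j⟩ :: t, v) = 0 := by
        intro k₁ k₂ hk
        have := key ⟨h', c, i, k₁⟩ ⟨h', !c, k₂, j⟩
          (by rintro ⟨-, -, h1, h2⟩; exact hk (h1.trans h2.symm))
        rwa [if_neg (by rintro ⟨-, -, h1, -⟩; exact hk h1.symm), mul_eq_zero] at this
      have diag : ∀ k₁, k₁ ≠ 0 → k₁ < G.dim h' (!c) →
          a (s ++ [⟨h', c, i, k₁⟩], e') * b (⟨h', !c, k₁, j⟩ :: t, v) =
          a (s ++ [⟨h', c, i, 0⟩], e') * b (⟨h', !c, 0, j⟩ :: t, v) := by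
        intro k₁ hk hlt
        have := key ⟨h', c, i, k₁⟩ ⟨h', !c, k₁, j⟩ (by rintro ⟨-, -, h1, -⟩; exact hk h1)
        rwa [if_pos ⟨rfl, rfl, rfl, hlt⟩] at this
      by_cases hk : k' = 0
      · subst hk
        -- Index 1 is available because the side has at least two elements.
        have h1 := diag 1 one_ne_zero (hdim _ _)
        rw [(off 0 1 zero_ne_one).resolve_left hp, mul_zero, eq_comm, mul_eq_zero] at h1
        exact h1.elim hp hq
      · have h1 := diag k' hk hxr
        rw [(off k' 0 hk).resolve_left hp, mul_zero, mul_eq_zero] at h1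
        exact h1.elim hp hq
    · have := key ⟨h, c, i, k⟩ ⟨h', c', k', j⟩
        (by rintro ⟨h1, h2, h3, h4⟩; exact hm ⟨h1, h2, h4.trans h3.symm⟩)
      rw [if_neg (by rintro ⟨h1, h2, h3, -⟩; exact hm ⟨h1, h2, h3⟩), mul_eq_zero] at this
      exact this.elim hp hq

end Sides
end DirectedHypergraph

/-! ### The free algebra acts on normal paths through the Leavitt path algebra -/

namespace DirectedHypergraph
namespace Sides

variable {V : Type u} {E : Type v} (G : Sides V E) {K : Type w} [Field K]

open scoped Classical in
theorem vact_vact (u v : V) (m : PathSpace K V E) :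
    G.vact K u (G.vact K v m) = if u = v then G.vact K u m else 0 := by
  induction m using Finsupp.induction_linear with
  | zero => simp
  | add m n h1 h2 => simp only [map_add, h1, h2]; split_ifs <;> simp
  | single q c =>
    obtain ⟨l, w⟩ := q
    rw [← mul_one c, ← smul_eq_mul, ← Finsupp.smul_single]
    simp only [map_smul, vact_single]
    by_cases h1 : G.start l w = v
    · subst h1
      simp only [if_true, vact_single, eq_comm (a := u)]
      split_ifs <;> simp
    · by_cases h2 : u = v
      · simp [h2, h1]
      · simp [h2, h1]

theorem act_vact_tgt (x : Arc E) (m : PathSpace K V E) :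
    G.act K x (G.vact K (G.tgt x) m) = G.act K x m := by
  classical
  induction m using Finsupp.induction_linear with
  | zero => simp
  | add m n h1 h2 => simp only [map_add, h1, h2]
  | single q c =>
    obtain ⟨l, w⟩ := q
    rw [← mul_one c, ← smul_eq_mul, ← Finsupp.smul_single]
    simp only [map_smul, vact_single]
    split_ifs with h
    · rfl
    · rw [G.act_single_of_ne (Ne.symm h), map_zero]

/-- Normality matters when `x` cancels against the first arc `y`: the remaining path starts at the
target of `y`, which is then the source of `x`. -/
theorem vact_src_act (x : Arc E) {m : PathSpace K V E} (hm : m ∈ G.normalSpace K) :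
    G.vact K (G.src x) (G.act K x m) = G.act K x m := by
  classical
  induction hm using normalSpace_induction with
  | zero => simp
  | add m n _ _ h1 h2 => simp only [map_add, h1, h2]
  | smul c m _ h => simp only [map_smul, h]
  | single l v hl =>
    by_cases h : G.tgt x = G.start l v
    · by_cases hf : Free x l
      · rw [G.act_single_of_free h hf, vact_single]; exact if_pos rfl
      · cases l with
        | nil => exact absurd (free_nil x) hf
        | cons y t =>
          rw [free_cons, not_not] at hf
          obtain ⟨hy, hyt, hft, ht⟩ := hl
          rw [G.act_single_of_collapses hf]
          obtain ⟨h1, h2, h3, h4⟩ := hf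
          rw [map_sub, map_sum]
          congr 1
          · split_ifs with hc
            · rw [vact_single, if_pos]
              rw [← hyt]; simp [tgt, src, h1, h2, hc]
            · simp
          · refine Finset.sum_congr rfl fun k _ => ?_
            rw [vact_single]; exact if_pos rfl
    · rw [G.act_single_of_ne h, map_zero]

end Sides

open Sides (ArcPath PathSpace)

variable {V : Type u} {E : Type v} {H : DirectedHypergraph V E}

instance neZero_sourceCard (h : E) : NeZero (H.sourceCard h) :=
  ⟨by simpa [sourceCard] using H.source_ne_zero h⟩

instance neZero_rangeCard (h : E) : NeZero (H.rangeCard h) :=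
  ⟨by simpa [rangeCard] using H.range_ne_zero h⟩

/-- The numerical description of an ordered hypergraph. -/
def Enumeration.sides (o : H.Enumeration) : Sides V E where
  dim h
    | true => H.sourceCard h
    | false => H.rangeCard h
  -- `Fin.ofNat` only makes the map total; it changes nothing for indices within the bounds.
  vtx h
    | true => fun i => o.src h (Fin.ofNat (H.sourceCard h) i)
    | false => fun j => o.rng h (Fin.ofNat (H.rangeCard h) j)

variable (H) in
/-- The letter corresponding to an arc; indices out of range are reduced. -/
def arcLetter : Arc E → H.Letter
  | ⟨h, true, i, j⟩ => .edge h (Fin.ofNat (H.sourceCard h) i) (Fin.ofNat (H.rangeCard h) j)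
  | ⟨h, false, j, i⟩ => .ghost h (Fin.ofNat (H.sourceCard h) i) (Fin.ofNat (H.rangeCard h) j)

/-- The word corresponding to a path. -/
def pathWord : ArcPath V E → H.Word
  | ([], v) => FreeSemigroup.of (.vert v)
  | (x :: l, _) => ⟨arcLetter H x, l.map (arcLetter H)⟩

namespace Enumeration

variable (K : Type w) [Field K] (o : H.Enumeration)

theorem letterSource_arcLetter (x : Arc E) : o.letterSource (arcLetter H x) = o.sides.src x := by
  obtain ⟨h, _ | _, i, j⟩ := x <;> rfl

theorem letterRange_arcLetter (x : Arc E) : o.letterRange (arcLetter H x) = o.sides.tgt x := by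
  obtain ⟨h, _ | _, i, j⟩ := x <;> rfl

/-- The left multiplication by a letter on the space of paths. -/
noncomputable def letterAct : H.Letter → Module.End K (PathSpace K V E)
  | .vert u => o.sides.vact K u
  | .edge h i j => o.sides.act K ⟨h, true, i, j⟩
  | .ghost h i j => o.sides.act K ⟨h, false, j, i⟩

theorem letterAct_arcLetter {x : Arc E} (hx : o.sides.InRange x) :
    o.letterAct K (arcLetter H x) = o.sides.act K x := by
  obtain ⟨h, _ | _, i, j⟩ := x
  · exact congrArg₂ (fun r c => o.sides.act K ⟨h, false, r, c⟩) (Nat.mod_eq_of_lt hx.1)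
      (Nat.mod_eq_of_lt hx.2)
  · exact congrArg₂ (fun r c => o.sides.act K ⟨h, true, r, c⟩) (Nat.mod_eq_of_lt hx.1)
      (Nat.mod_eq_of_lt hx.2)

/-- The action of the free algebra on the space of paths. -/
noncomputable def freeAct : FreeAlg K H →ₙₐ[K] Module.End K (PathSpace K V E) :=
  MonoidAlgebra.liftMagma K (FreeSemigroup.lift (o.letterAct K))

theorem freeAct_single (p : H.Word) :
    o.freeAct K (MonoidAlgebra.single p 1) = FreeSemigroup.lift (o.letterAct K) p := by
  simp [freeAct]

theorem freeAct_toFree (x : H.Letter) : o.freeAct K (x.toFree K) = o.letterAct K x := by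
  rw [Letter.toFree, freeAct_single, FreeSemigroup.lift_of]

theorem letterAct_mem (x : H.Letter) {m : PathSpace K V E} (hm : m ∈ o.sides.normalSpace K) :
    o.letterAct K x m ∈ o.sides.normalSpace K := by
  cases x with
  | vert u => exact o.sides.vact_mem_normalSpace u hm
  | edge h i j => exact o.sides.act_mem_normalSpace (x := ⟨h, true, i, j⟩) ⟨i.2, j.2⟩ hm
  | ghost h i j => exact o.sides.act_mem_normalSpace (x := ⟨h, false, j, i⟩) ⟨j.2, i.2⟩ hm

theorem freeAct_mem (f : FreeAlg K H) {m : PathSpace K V E} (hm : m ∈ o.sides.normalSpace K) :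
    o.freeAct K f m ∈ o.sides.normalSpace K := by
  induction f using MonoidAlgebra.induction_linear with
  | zero => rw [map_zero]; exact zero_mem _
  | add f g h1 h2 => rw [map_add]; exact add_mem h1 h2
  | single p c =>
    rw [← mul_one c, ← MonoidAlgebra.smul_single', map_smul, freeAct_single]
    refine Submodule.smul_mem _ _ ?_
    induction p using FreeSemigroup.recOnMul with
    | ih1 x => exact o.letterAct_mem K x hm
    | ih2 x p h1 h2 =>
      rw [FreeSemigroup.lift_of_mul]
      exact o.letterAct_mem K x h2

theorem freeAct_eq_of_rel {a b : FreeAlg K H} (hab : Rel K o a b) {m : PathSpace K V E}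
    (hm : m ∈ o.sides.normalSpace K) : o.freeAct K a m = o.freeAct K b m := by
  classical
  have hsrc : ∀ h i, o.sides.vtx h true (i : Fin (H.sourceCard h)) = o.src h i := fun h i => by
    simp [sides]
  have hrng : ∀ h i, o.sides.vtx h false (i : Fin (H.rangeCard h)) = o.rng h i := fun h i => by
    simp [sides]
  cases hab with
  | vert_mul_vert x y =>
    rw [map_mul, freeAct_toFree, freeAct_toFree, Module.End.mul_apply]
    simp only [letterAct, Sides.vact_vact]
    split_ifs
    · rw [freeAct_toFree]; rfl
    · simp
  | src_mul_edge h i j =>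
    rw [map_mul, freeAct_toFree, freeAct_toFree, Module.End.mul_apply, ← hsrc]
    exact o.sides.vact_src_act ⟨h, true, i, j⟩ hm
  | edge_mul_rng h i j =>
    rw [map_mul, freeAct_toFree, freeAct_toFree, Module.End.mul_apply, ← hrng]
    exact o.sides.act_vact_tgt ⟨h, true, i, j⟩ m
  | rng_mul_ghost h i j =>
    rw [map_mul, freeAct_toFree, freeAct_toFree, Module.End.mul_apply, ← hrng]
    exact o.sides.vact_src_act ⟨h, false, j, i⟩ hm
  | ghost_mul_src h i j =>
    rw [map_mul, freeAct_toFree, freeAct_toFree, Module.End.mul_apply, ← hsrc]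
    exact o.sides.act_vact_tgt ⟨h, false, j, i⟩ m
  | sum_edge_ghost h i j =>
    have := o.sides.sum_act_act h true (j := j) (Nat.pos_of_ne_zero (NeZero.ne (H.rangeCard h)))
      i.2 hm
    rw [Finset.sum_range] at this
    rw [map_sum, LinearMap.sum_apply]
    simp only [map_mul, freeAct_toFree, Module.End.mul_apply]
    refine Eq.trans this ?_
    simp only [Fin.val_inj]
    split_ifs
    · rw [freeAct_toFree, hsrc]; rfl
    · simp
  | sum_ghost_edge h i j =>
    have := o.sides.sum_act_act h false (j := j) (Nat.pos_of_ne_zero (NeZero.ne (H.sourceCard h)))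
      i.2 hm
    rw [Finset.sum_range] at this
    rw [map_sum, LinearMap.sum_apply]
    simp only [map_mul, freeAct_toFree, Module.End.mul_apply]
    refine Eq.trans this ?_
    simp only [Fin.val_inj]
    split_ifs
    · rw [freeAct_toFree, hrng]; rfl
    · simp

/-- The annihilator of `normalSpace` contains the relations, and it is a two-sided ideal because
`normalSpace` is invariant. -/
theorem freeAct_eq_zero {f : FreeAlg K H} (hf : f ∈ o.relIdeal K) {m : PathSpace K V E}
    (hm : m ∈ o.sides.normalSpace K) : o.freeAct K f m = 0 := by
  let I : Submodule K (FreeAlg K H) :=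
    { carrier := {f | ∀ m ∈ o.sides.normalSpace K, o.freeAct K f m = 0}
      add_mem' := fun {f g} hf hg m hm => by simp [hf m hm, hg m hm]
      zero_mem' := fun m _ => by simp
      smul_mem' := fun c f hf m hm => by simp [hf m hm] }
  have hI : o.relIdeal K ≤ I := by
    refine sInf_le ⟨fun a b hab m hm => ?_, fun a x hx => ⟨fun m hm => ?_, fun m hm => ?_⟩⟩
    · rw [map_sub, LinearMap.sub_apply, o.freeAct_eq_of_rel K hab hm, sub_self]
    · rw [map_mul, Module.End.mul_apply, hx m hm, map_zero]
    · rw [map_mul, Module.End.mul_apply, hx _ (o.freeAct_mem K a hm)]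
  exact hI hf m hm

end Enumeration
end DirectedHypergraph

/-! ### Normal paths form a basis of the Leavitt path algebra -/

namespace DirectedHypergraph

open Sides (ArcPath PathSpace)

variable {V : Type u} {E : Type v} {H : DirectedHypergraph V E}

namespace Enumeration

variable (K : Type w) [Field K] (o : H.Enumeration)

/-- For nonempty `l` the word does not mention `v`; the projection `vact` is harmless since the last
arc kills all paths not starting at its target. -/
theorem freeAct_pathWord {l : List (Arc E)} {v : V} (hl : o.sides.IsNormal l v)
    (m : PathSpace K V E) :
    o.freeAct K (MonoidAlgebra.single (pathWord (l, v)) 1) m =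
      o.sides.listAct K l (o.sides.vact K v m) := by
  rw [freeAct_single]
  induction l with
  | nil => rfl
  | cons x l ih =>
    have hx := o.letterAct_arcLetter K hl.1
    cases l with
    | nil =>
      obtain rfl : o.sides.tgt x = v := hl.2.1
      exact (congrArg (fun f => f m) hx).trans (o.sides.act_vact_tgt x m).symm
    | cons y t =>
      have hw : (pathWord (x :: y :: t, v) : H.Word) =
        FreeSemigroup.of (arcLetter H x) * pathWord (y :: t, v) := rfl
      rw [hw, FreeSemigroup.lift_of_mul, hx, Module.End.mul_apply, ih hl.2.2.2]
      rfl

end Enumeration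

variable (H) in
/-- The linear map from the space of paths to the free algebra. -/
noncomputable def pathFree (K : Type w) [Field K] : PathSpace K V E →ₗ[K] FreeAlg K H :=
  Finsupp.linearCombination K fun q => MonoidAlgebra.single (pathWord q) 1

theorem pathFree_single (K : Type w) [Field K] (q : ArcPath V E) :
    pathFree H K (Finsupp.single q 1) = MonoidAlgebra.single (pathWord q) 1 := by
  simp [pathFree]

theorem coeff_pathFree (K : Type w) [Field K] (m : PathSpace K V E) :
    (pathFree H K m).coeff = m.mapDomain pathWord := by
  rw [pathFree, Finsupp.linearCombination_apply, MonoidAlgebra.coeff_finsuppSum, Finsupp.mapDomain]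
  simp [MonoidAlgebra.coeff_single]

namespace LeavittPathAlgebra

variable (K : Type w) [Field K] (o : H.Enumeration)

/-- The image of a vertex in the Leavitt path algebra. -/
noncomputable def vertex (u : V) : LeavittPathAlgebra K o := mk K o ((Letter.vert u).toFree K)

/-- The image of an arc in the Leavitt path algebra. -/
noncomputable def arc (x : Arc E) : LeavittPathAlgebra K o := mk K o ((arcLetter H x).toFree K)

variable {K o}

theorem mk_eq_of_rel {a b : FreeAlg K H} (h : Enumeration.Rel K o a b) : mk K o a = mk K o b :=
  (mk_eq_mk_iff K o a b).2 (o.rel_sub_mem K h)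

open scoped Classical in
theorem vertex_mul_vertex (u v : V) :
    vertex K o u * vertex K o v = if u = v then vertex K o u else 0 := by
  rw [vertex, vertex, ← mk_mul, mk_eq_of_rel (.vert_mul_vert u v)]
  split_ifs
  · rfl
  · exact map_zero _

theorem vertex_src_mul_arc (x : Arc E) : vertex K o (o.sides.src x) * arc K o x = arc K o x := by
  obtain ⟨h, _ | _, i, j⟩ := x
  · exact mk_eq_of_rel (.rng_mul_ghost h _ _)
  · exact mk_eq_of_rel (.src_mul_edge h _ _)

theorem arc_mul_vertex_tgt (x : Arc E) : arc K o x * vertex K o (o.sides.tgt x) = arc K o x := by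
  obtain ⟨h, _ | _, i, j⟩ := x
  · exact mk_eq_of_rel (.ghost_mul_src h _ _)
  · exact mk_eq_of_rel (.edge_mul_rng h _ _)

theorem arc_edge (h : E) (i : Fin (H.sourceCard h)) (j : Fin (H.rangeCard h)) :
    arc K o ⟨h, true, i, j⟩ = mk K o ((Letter.edge h i j).toFree K) := by
  simp [arc, arcLetter]

theorem arc_ghost (h : E) (i : Fin (H.sourceCard h)) (j : Fin (H.rangeCard h)) :
    arc K o ⟨h, false, j, i⟩ = mk K o ((Letter.ghost h i j).toFree K) := by
  simp [arc, arcLetter]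

open scoped Classical in
theorem sum_arc_mul_arc (h : E) (b : Bool) {i j : ℕ} (hi : i < o.sides.dim h b)
    (hj : j < o.sides.dim h b) :
    ∑ k ∈ Finset.range (o.sides.dim h (!b)), arc K o ⟨h, b, i, k⟩ * arc K o ⟨h, !b, k, j⟩ =
      if i = j then vertex K o (o.sides.vtx h b i) else 0 := by
  rw [Finset.sum_range]
  cases b with
  | true =>
    obtain ⟨i, rfl⟩ : ∃ i' : Fin (H.sourceCard h), (i' : ℕ) = i := ⟨⟨i, hi⟩, rfl⟩
    obtain ⟨j, rfl⟩ : ∃ j' : Fin (H.sourceCard h), (j' : ℕ) = j := ⟨⟨j, hj⟩, rfl⟩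
    have := mk_eq_of_rel (K := K) (o := o) (.sum_edge_ghost h i j)
    rw [map_sum] at this
    refine (Finset.sum_congr rfl fun k _ => ?_).trans (this.trans ?_)
    · rw [mk_mul]
      exact congrArg₂ (· * ·) (arc_edge h _ k) (arc_ghost h _ k)
    · have hv : o.sides.vtx h true i = o.src h i := congrArg (o.src h) (Fin.ofNat_val_eq_self i)
      simp only [hv, Fin.val_inj]
      split_ifs
      · rfl
      · exact map_zero _
  | false =>
    obtain ⟨i, rfl⟩ : ∃ i' : Fin (H.rangeCard h), (i' : ℕ) = i := ⟨⟨i, hi⟩, rfl⟩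
    obtain ⟨j, rfl⟩ : ∃ j' : Fin (H.rangeCard h), (j' : ℕ) = j := ⟨⟨j, hj⟩, rfl⟩
    have := mk_eq_of_rel (K := K) (o := o) (.sum_ghost_edge h i j)
    rw [map_sum] at this
    refine (Finset.sum_congr rfl fun k _ => ?_).trans (this.trans ?_)
    · rw [mk_mul]
      exact congrArg₂ (· * ·) ((fun h i k => arc_ghost h k i) h _ k) ((fun h i k => arc_edge h k i) h _ k)
    · have hv : o.sides.vtx h false i = o.rng h i := congrArg (o.rng h) (Fin.ofNat_val_eq_self i)
      simp only [hv, Fin.val_inj]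
      split_ifs
      · rfl
      · exact map_zero _

variable (K o) in
/-- The linear map from the space of paths to the Leavitt path algebra. -/
noncomputable def ofPaths : PathSpace K V E →ₗ[K] LeavittPathAlgebra K o :=
  mk K o ∘ₗ pathFree H K

theorem ofPaths_nil (v : V) : ofPaths K o (Finsupp.single ([], v) 1) = vertex K o v := by
  rw [ofPaths, LinearMap.comp_apply, pathFree_single]
  rfl

theorem ofPaths_cons {x : Arc E} {l : List (Arc E)} {v : V} (h : o.sides.tgt x = o.sides.start l v) :
    ofPaths K o (Finsupp.single (x :: l, v) 1) =
      arc K o x * ofPaths K o (Finsupp.single (l, v) 1) := by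
  cases l with
  | nil =>
    obtain rfl : o.sides.tgt x = v := h
    rw [ofPaths_nil, arc_mul_vertex_tgt, ofPaths, LinearMap.comp_apply, pathFree_single]
    rfl
  | cons y t =>
    rw [ofPaths, LinearMap.comp_apply, LinearMap.comp_apply, pathFree_single, pathFree_single, arc,
      ← mk_mul, Letter.toFree, MonoidAlgebra.single_mul_single, mul_one]
    rfl

theorem vertex_start_mul_ofPaths {l : List (Arc E)} {v : V} (h : o.sides.IsNormal l v) :
    vertex K o (o.sides.start l v) * ofPaths K o (Finsupp.single (l, v) 1) =
      ofPaths K o (Finsupp.single (l, v) 1) := by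
  cases l with
  | nil => rw [ofPaths_nil]; simp [Sides.start, vertex_mul_vertex]
  | cons x l => rw [ofPaths_cons h.2.1, ← mul_assoc, Sides.start, vertex_src_mul_arc]

theorem ofPaths_mul_vertex {l : List (Arc E)} {v : V} (h : o.sides.IsNormal l v) :
    ofPaths K o (Finsupp.single (l, v) 1) * vertex K o v =
      ofPaths K o (Finsupp.single (l, v) 1) := by
  induction l with
  | nil => rw [ofPaths_nil]; simp [vertex_mul_vertex]
  | cons x l ih => rw [ofPaths_cons h.2.1, mul_assoc, ih h.2.2.2]

theorem ofPaths_vact (u : V) {m : PathSpace K V E} (hm : m ∈ o.sides.normalSpace K) :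
    ofPaths K o (o.sides.vact K u m) = vertex K o u * ofPaths K o m := by
  classical
  induction hm using Sides.normalSpace_induction with
  | zero => simp
  | add m n _ _ h1 h2 => simp only [map_add, h1, h2, mul_add]
  | smul c m _ h => simp only [map_smul, h, mul_smul_comm]
  | single l v hl =>
    rw [Sides.vact_single, ← vertex_start_mul_ofPaths hl, ← mul_assoc, vertex_mul_vertex]
    simp only [eq_comm (a := u)]
    split_ifs with h
    · rw [← h, vertex_start_mul_ofPaths hl]
    · simp

/-- Each clause in the definition of `act` is an identity in the algebra; the collapsing one is a
relation solved for its term of index 0. -/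
theorem ofPaths_act {x : Arc E} (hx : o.sides.InRange x) {m : PathSpace K V E}
    (hm : m ∈ o.sides.normalSpace K) :
    ofPaths K o (o.sides.act K x m) = arc K o x * ofPaths K o m := by
  classical
  induction hm using Sides.normalSpace_induction with
  | zero => simp
  | add m n _ _ h1 h2 => simp only [map_add, h1, h2, mul_add]
  | smul c m _ h => simp only [map_smul, h, mul_smul_comm]
  | single l v hl =>
    by_cases h : o.sides.tgt x = o.sides.start l v
    · by_cases hf : Sides.Free x l
      · rw [Sides.act_single_of_free _ h hf, ofPaths_cons h]
      · cases l with
        | nil => exact absurd (Sides.free_nil x) hf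
        | cons y t =>
          rw [Sides.free_cons, not_not] at hf
          obtain ⟨hy, hyt, hft, ht⟩ := hl
          rw [Sides.act_single_of_collapses _ hf, ofPaths_cons hyt, ← mul_assoc, map_sub, map_sum]
          obtain ⟨_, b, i, _⟩ := x
          obtain ⟨a, _, _, j⟩ := y
          obtain ⟨h1, h2, h3, h4⟩ := hf
          simp only at h1 h2 h3 h4
          subst h1 h2 h3 h4
          have hj : j < o.sides.dim a b := by simpa [Sides.InRange] using hy.2
          have hsum := sum_arc_mul_arc (K := K) (o := o) a b hx.1 hj
          rw [Finset.range_eq_Ico, Finset.sum_eq_sum_Ico_succ_bot (Nat.zero_lt_of_lt hx.2),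
            ← eq_sub_iff_add_eq] at hsum
          rw [hsum, sub_mul, Finset.sum_mul]
          have hyt' : o.sides.vtx a b j = o.sides.start t v := by simpa [Sides.tgt] using hyt
          congr 1
          · simp only [eq_comm (a := j)]
            split_ifs with hij
            · rw [hij, hyt', vertex_start_mul_ofPaths ht]
            · simp
          · refine Finset.sum_congr rfl fun k _ => ?_
            rw [ofPaths_cons (by rfl), ofPaths_cons (by simpa [Sides.tgt] using hyt'), mul_assoc]
    -- Non-composable factors multiply to zero because the two distinct vertices inserted between
    -- them are orthogonal.
    · rw [Sides.act_single_of_ne _ h, ← vertex_start_mul_ofPaths hl, ← arc_mul_vertex_tgt x,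
        mul_assoc, ← mul_assoc (vertex K o _), vertex_mul_vertex, if_neg h]
      simp

theorem ofPaths_letterAct (x : H.Letter) {m : PathSpace K V E} (hm : m ∈ o.sides.normalSpace K) :
    ofPaths K o (o.letterAct K x m) = mk K o (x.toFree K) * ofPaths K o m := by
  cases x with
  | vert u => exact ofPaths_vact u hm
  | edge h i j =>
    refine (ofPaths_act (x := ⟨h, true, i, j⟩) ⟨i.2, j.2⟩ hm).trans ?_
    rw [arc_edge]
  | ghost h i j =>
    refine (ofPaths_act (x := ⟨h, false, j, i⟩) ⟨j.2, i.2⟩ hm).trans ?_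
    rw [arc_ghost]

theorem ofPaths_freeAct (f : FreeAlg K H) {m : PathSpace K V E}
    (hm : m ∈ o.sides.normalSpace K) :
    ofPaths K o (o.freeAct K f m) = mk K o f * ofPaths K o m := by
  induction f using MonoidAlgebra.induction_linear with
  | zero => simp
  | add f g h1 h2 => simp only [map_add, LinearMap.add_apply, h1, h2, add_mul]
  | single p c =>
    rw [← mul_one c, ← MonoidAlgebra.smul_single', map_smul, map_smul, LinearMap.smul_apply,
      map_smul, smul_mul_assoc]
    congr 1
    induction p using FreeSemigroup.recOnMul with
    | ih1 x =>
      rw [o.freeAct_single K, FreeSemigroup.lift_of]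
      exact ofPaths_letterAct x hm
    | ih2 x p h1 h2 =>
      have h3 : (MonoidAlgebra.single (FreeSemigroup.of x * p) 1 : FreeAlg K H) =
          x.toFree K * MonoidAlgebra.single p 1 := by
        rw [Letter.toFree, MonoidAlgebra.single_mul_single, mul_one]
      rw [h3, map_mul, Module.End.mul_apply, o.freeAct_toFree K,
        ofPaths_letterAct x (o.freeAct_mem K _ hm), h2, mk_mul, mul_assoc]

/-- The image of `normalSpace` is stable under left multiplication by letters, and a letter is
itself times the vertex at its range. Induction on words gives everything. -/
theorem exists_ofPaths_eq (a : LeavittPathAlgebra K o) :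
    ∃ m ∈ o.sides.normalSpace K, ofPaths K o m = a := by
  change a ∈ (o.sides.normalSpace K).map (ofPaths K o)
  obtain ⟨f, rfl⟩ := mk_surjective K o a
  induction f using MonoidAlgebra.induction_linear with
  | zero => rw [map_zero]; exact zero_mem _
  | add f g h1 h2 => rw [map_add]; exact add_mem h1 h2
  | single p c =>
    rw [← mul_one c, ← MonoidAlgebra.smul_single', map_smul]
    refine Submodule.smul_mem _ _ ?_
    induction p using FreeSemigroup.recOnMul with
    | ih1 x =>
      have hn : Finsupp.single (([], o.letterRange x) : ArcPath V E) (1 : K) ∈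
        o.sides.normalSpace K := Sides.single_mem_normalSpace o.sides K (q := (([], o.letterRange x) : ArcPath V E)) trivial 1
      refine ⟨_, o.letterAct_mem K x hn, ?_⟩
      rw [ofPaths_letterAct x hn, ofPaths_nil]
      cases x with
      | vert u => classical exact (vertex_mul_vertex u u).trans (if_pos rfl)
      | edge h i j => exact mk_eq_of_rel (.edge_mul_rng h i j)
      | ghost h i j => exact mk_eq_of_rel (.ghost_mul_src h i j)
    | ih2 x p h1 h2 =>
      obtain ⟨m, hm, hmp⟩ := h2
      refine ⟨_, o.letterAct_mem K x hm, ?_⟩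
      rw [ofPaths_letterAct x hm, hmp, ← mk_mul, Letter.toFree, MonoidAlgebra.single_mul_single,
        mul_one]

open scoped Classical in
-- Multiplying by the vertex `v` on the right selects the paths ending at `v`. Varying `v` recovers
-- `m`, which yields linear independence.
theorem freeAct_pathFree {m : PathSpace K V E} (hm : m ∈ o.sides.normalSpace K) (v : V) :
    o.freeAct K (pathFree H K m) (Finsupp.single ([], v) 1) = m.filter fun q => q.2 = v := by
  induction hm using Sides.normalSpace_induction with
  | zero => rw [map_zero, map_zero, Finsupp.filter_zero]; rfl
  | add m n _ _ h1 h2 => simp only [map_add, LinearMap.add_apply, h1, h2, Finsupp.filter_add]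
  | smul c m _ h => simp only [map_smul, LinearMap.smul_apply, h, Finsupp.filter_smul]
  | single l w hl =>
    rw [pathFree_single, o.freeAct_pathWord K hl, Sides.vact_single]
    simp only [Sides.start, eq_comm (a := v)]
    split_ifs with h
    · subst h
      rw [Sides.listAct_single_of_isNormal _ (by simpa using hl), List.append_nil,
        Finsupp.filter_single_of_pos (fun q : ArcPath V E => q.2 = w) rfl]
    · rw [map_zero, Finsupp.filter_single_of_neg (fun q : ArcPath V E => q.2 = v) h]

theorem eq_zero_of_ofPaths_eq_zero {m : PathSpace K V E} (hm : m ∈ o.sides.normalSpace K)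
    (h : ofPaths K o m = 0) : m = 0 := by
  classical
  have hmem : pathFree H K m ∈ o.relIdeal K := (Submodule.Quotient.mk_eq_zero _).1 h
  ext ⟨l, v⟩
  have h1 := o.freeAct_eq_zero K hmem
    (Sides.single_mem_normalSpace o.sides K (q := (([], v) : ArcPath V E)) trivial 1)
  rw [freeAct_pathFree hm] at h1
  simpa using DFunLike.congr_fun h1 (l, v)

variable (K o) in
/-- The space of normal elements is isomorphic to the Leavitt path algebra. -/
noncomputable def normalEquiv : o.sides.normalSpace K ≃ₗ[K] LeavittPathAlgebra K o :=
  LinearEquiv.ofBijective ((ofPaths K o).domRestrict (o.sides.normalSpace K))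
    ⟨(injective_iff_map_eq_zero _).2 fun m h => Subtype.ext (eq_zero_of_ofPaths_eq_zero m.2 h),
      fun a => let ⟨m, hm, h⟩ := exists_ofPaths_eq a; ⟨⟨m, hm⟩, h⟩⟩

variable (K o) in
/-- The coordinates of an element of the Leavitt path algebra with respect to the basis of normal
paths. -/
noncomputable def coords : LeavittPathAlgebra K o →ₗ[K] PathSpace K V E :=
  (o.sides.normalSpace K).subtype ∘ₗ (normalEquiv K o).symm.toLinearMap

theorem coords_mem (a : LeavittPathAlgebra K o) : coords K o a ∈ o.sides.normalSpace K :=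
  ((normalEquiv K o).symm a).2

theorem ofPaths_coords (a : LeavittPathAlgebra K o) : ofPaths K o (coords K o a) = a :=
  (normalEquiv K o).apply_symm_apply a

theorem coords_ofPaths {m : PathSpace K V E} (hm : m ∈ o.sides.normalSpace K) :
    coords K o (ofPaths K o m) = m :=
  congrArg Subtype.val ((normalEquiv K o).symm_apply_apply ⟨m, hm⟩)

theorem coords_injective : Function.Injective (coords K o) :=
  Function.LeftInverse.injective ofPaths_coords

theorem coords_mk_mul (f : FreeAlg K H) (a : LeavittPathAlgebra K o) :
    coords K o (mk K o f * a) = o.freeAct K f (coords K o a) := by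
  rw [← coords_ofPaths (o.freeAct_mem K f (coords_mem a)), ofPaths_freeAct f (coords_mem a),
    ofPaths_coords]

theorem isNormal_of_mem_support {a : LeavittPathAlgebra K o} {q : ArcPath V E}
    (hq : q ∈ (coords K o a).support) : o.sides.IsNormal q.1 q.2 :=
  (Finsupp.mem_supported K _).1 (coords_mem a) hq

end LeavittPathAlgebra
end DirectedHypergraph

/-! ### Identification of normal paths with nod-paths -/

namespace DirectedHypergraph

open Sides (ArcPath PathSpace)

variable {V : Type u} {E : Type v} {H : DirectedHypergraph V E}

theorem not_isVertex_arcLetter (x : Arc E) : ¬ (arcLetter H x).IsVertex := by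
  obtain ⟨h, _ | _, i, j⟩ := x <;> exact not_false

theorem pathLength_pathWord (q : ArcPath V E) : pathLength (pathWord q : H.Word) = q.1.length := by
  obtain ⟨l, v⟩ := q
  cases l with
  | nil => rfl
  | cons x l =>
    obtain ⟨h, _ | _, i, j⟩ := x <;>
      simp [pathWord, arcLetter, pathLength, FreeSemigroup.length]

theorem letters_pathWord_cons (x : Arc E) (l : List (Arc E)) (v : V) :
    (pathWord (x :: l, v) : H.Word).letters = (x :: l).map (arcLetter H) := rfl

namespace Enumeration

variable (o : H.Enumeration)

theorem exists_arcLetter_eq {a : H.Letter} (ha : ¬ a.IsVertex) :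
    ∃ x, o.sides.InRange x ∧ arcLetter H x = a := by
  cases a with
  | vert u => exact absurd trivial ha
  | edge h i j => exact ⟨⟨h, true, i, j⟩, ⟨i.2, j.2⟩, by simp [arcLetter]⟩
  | ghost h i j => exact ⟨⟨h, false, j, i⟩, ⟨j.2, i.2⟩, by simp [arcLetter]⟩

variable {o}

theorem arcLetter_injOn {x y : Arc E} (hx : o.sides.InRange x) (hy : o.sides.InRange y)
    (h : arcLetter H x = arcLetter H y) : x = y := by
  obtain ⟨e, _ | _, i, j⟩ := x <;> obtain ⟨e', _ | _, i', j'⟩ := y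
  · obtain ⟨rfl, h1, h2⟩ := Letter.ghost.inj h
    obtain rfl : j = j' := (Nat.mod_eq_of_lt hx.2).symm.trans
      ((congrArg Fin.val (eq_of_heq h1)).trans (Nat.mod_eq_of_lt hy.2))
    obtain rfl : i = i' := (Nat.mod_eq_of_lt hx.1).symm.trans
      ((congrArg Fin.val (eq_of_heq h2)).trans (Nat.mod_eq_of_lt hy.1))
    rfl
  · cases h
  · cases h
  · obtain ⟨rfl, h1, h2⟩ := Letter.edge.inj h
    obtain rfl : i = i' := (Nat.mod_eq_of_lt hx.1).symm.trans
      ((congrArg Fin.val (eq_of_heq h1)).trans (Nat.mod_eq_of_lt hy.1))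
    obtain rfl : j = j' := (Nat.mod_eq_of_lt hx.2).symm.trans
      ((congrArg Fin.val (eq_of_heq h2)).trans (Nat.mod_eq_of_lt hy.2))
    rfl

variable (o) in
theorem exists_collapses_of_forbidden {q : H.Word} (hq : H.Forbidden q) :
    ∃ x y, o.sides.InRange x ∧ o.sides.InRange y ∧ x.Collapses y ∧
      q.letters = [arcLetter H x, arcLetter H y] := by
  cases hq with
  | edge_ghost h i j k hk =>
    refine ⟨⟨h, true, i, k⟩, ⟨h, false, k, j⟩, ⟨i.2, k.2⟩, ⟨k.2, j.2⟩, ⟨rfl, rfl, hk, hk⟩, ?_⟩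
    simp only [arcLetter, Fin.ofNat_val_eq_self]
    rfl
  | ghost_edge h i j k hk =>
    refine ⟨⟨h, false, i, k⟩, ⟨h, true, k, j⟩, ⟨i.2, k.2⟩, ⟨k.2, j.2⟩, ⟨rfl, rfl, hk, hk⟩, ?_⟩
    simp only [arcLetter, Fin.ofNat_val_eq_self]
    rfl

theorem forbidden_of_collapses {x y : Arc E} (h : x.Collapses y) :
    H.Forbidden (FreeSemigroup.of (arcLetter H x) * FreeSemigroup.of (arcLetter H y)) := by
  obtain ⟨e, b, i, k⟩ := x
  obtain ⟨e', b', k', j⟩ := y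
  obtain ⟨h1, h2, h3, h4⟩ := h
  simp only at h1 h2 h3 h4
  subst h1 h2 h3 h4
  cases b
  · exact .ghost_edge _ _ _ _ (by simp)
  · exact .edge_ghost _ _ _ _ (by simp)

theorem isDPath_pathWord {l : List (Arc E)} {v : V} (hl : o.sides.IsNormal l v) :
    o.IsDPath (pathWord (l, v)) := by
  cases l with
  | nil => exact Or.inl ⟨v, rfl⟩
  | cons x l =>
    refine Or.inr ⟨fun a ha => ?_, ?_⟩
    · rw [letters_pathWord_cons, List.mem_map] at ha
      obtain ⟨y, -, rfl⟩ := ha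
      exact not_isVertex_arcLetter y
    · rw [letters_pathWord_cons]
      induction l generalizing x with
      | nil => simp
      | cons y l ih =>
        rw [List.map_cons, List.map_cons, List.isChain_cons_cons]
        refine ⟨?_, ih y hl.2.2.2⟩
        rw [letterRange_arcLetter, letterSource_arcLetter]
        exact hl.2.1

theorem not_forbidden_infix {l : List (Arc E)} {v : V} (hl : o.sides.IsNormal l v) {q : H.Word}
    (hq : H.Forbidden q) : ¬ q.letters <:+: l.map (arcLetter H) := by
  obtain ⟨x, y, hx, hy, hxy, hqxy⟩ := o.exists_collapses_of_forbidden hq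
  rw [hqxy]
  induction l with
  | nil => simp
  | cons z l ih =>
    obtain ⟨hz, -, hf, hl⟩ := hl
    rw [List.map_cons, List.infix_cons_iff]
    refine not_or.2 ⟨?_, ih hl⟩
    cases l with
    | nil => simp
    | cons t l =>
      simp only [List.map_cons, List.cons_prefix_cons, List.nil_prefix, and_true]
      rintro ⟨h1, h2⟩
      obtain rfl := arcLetter_injOn hx hz h1
      obtain rfl := arcLetter_injOn hy hl.1 h2
      exact Sides.free_cons.1 hf hxy

theorem isNodPath_pathWord {q : ArcPath V E} (hq : o.sides.IsNormal q.1 q.2) :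
    o.IsNodPath (pathWord q) := by
  obtain ⟨l, v⟩ := q
  refine ⟨isDPath_pathWord hq, fun q hf => ?_⟩
  cases l with
  | nil =>
    obtain ⟨x, y, -, -, -, h⟩ := o.exists_collapses_of_forbidden hf
    intro hi
    have := hi.length_le
    rw [h] at this
    simp [pathWord, Word.letters] at this
  | cons x l => exact not_forbidden_infix hq hf

theorem exists_pathWord_eq {p : H.Word} (hp : o.IsNodPath p) :
    ∃ q : ArcPath V E, o.sides.IsNormal q.1 q.2 ∧ pathWord q = p := by
  obtain ⟨⟨v, rfl⟩ | ⟨hv, hc⟩, hf⟩ := hp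
  · exact ⟨([], v), trivial, rfl⟩
  have key : ∀ (a : H.Letter) (L : List H.Letter), (∀ x ∈ a :: L, ¬ x.IsVertex) →
      ((a :: L).IsChain fun x y => o.letterRange x = o.letterSource y) →
      (∀ q : H.Word, H.Forbidden q → ¬ q.letters <:+: a :: L) →
      ∃ x l v, o.sides.IsNormal (x :: l) v ∧ (x :: l).map (arcLetter H) = a :: L := by
    intro a L
    induction L generalizing a with
    | nil =>
      intro h _ _
      obtain ⟨x, hx, rfl⟩ := o.exists_arcLetter_eq (h a (by simp))
      exact ⟨x, [], o.sides.tgt x, ⟨hx, rfl, Sides.free_nil x, trivial⟩, rfl⟩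
    | cons b L ih =>
      intro h hc hf
      obtain ⟨x, hx, rfl⟩ := o.exists_arcLetter_eq (h a (by simp))
      rw [List.isChain_cons_cons] at hc
      obtain ⟨y, l, v, hy, hL⟩ := ih b (fun z hz => h z (List.mem_cons_of_mem _ hz)) hc.2
        fun q hq hi => hf q hq (hi.trans (List.infix_cons (List.infix_refl _)))
      rw [List.map_cons, List.cons.injEq] at hL
      obtain ⟨rfl, rfl⟩ := hL
      refine ⟨x, y :: l, v, ⟨hx, ?_, ?_, hy⟩, rfl⟩
      · rw [← letterRange_arcLetter, hc.1, letterSource_arcLetter]; rfl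
      · rw [Sides.free_cons]
        intro hxy
        refine hf _ (forbidden_of_collapses hxy) (List.IsPrefix.isInfix ?_)
        exact ⟨l.map (arcLetter H), rfl⟩
  obtain ⟨a, L⟩ := p
  obtain ⟨x, l, v, h, hL⟩ := key a L hv hc hf
  refine ⟨(x :: l, v), h, ?_⟩
  rw [List.map_cons, List.cons.injEq] at hL
  obtain ⟨rfl, rfl⟩ := hL
  rfl

theorem nodSpan_eq (K : Type w) [Field K] :
    o.nodSpan K = (o.sides.normalSpace K).map (pathFree H K) := by
  rw [nodSpan, Sides.normalSpace, Finsupp.supported_eq_span_single, Submodule.map_span]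
  congr 1
  ext f
  constructor
  · rintro ⟨p, hp, rfl⟩
    obtain ⟨q, hq, rfl⟩ := exists_pathWord_eq hp
    exact ⟨_, ⟨q, hq, rfl⟩, pathFree_single K q⟩
  · rintro ⟨_, ⟨q, hq, rfl⟩, rfl⟩
    exact ⟨_, isNodPath_pathWord hq, pathFree_single K q⟩

end Enumeration

/-! ### Normal forms, enough idempotents and the local valuation -/

namespace LeavittPathAlgebra

variable {K : Type w} [Field K] {o : H.Enumeration}

variable (o) in
-- Equal words have equal images in the algebra, whose coordinates determine the path. The field is
-- irrelevant, so ℚ serves.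
theorem pathWord_injOn :
    Set.InjOn (pathWord : ArcPath V E → H.Word) {q | o.sides.IsNormal q.1 q.2} := by
  intro p hp q hq h
  have h1 : ofPaths ℚ o (Finsupp.single p 1) = ofPaths ℚ o (Finsupp.single q 1) := by
    rw [ofPaths, LinearMap.comp_apply, LinearMap.comp_apply, pathFree_single, pathFree_single, h]
  have h2 := congrArg (coords ℚ o) h1
  rw [coords_ofPaths (Sides.single_mem_normalSpace _ _ hp _),
    coords_ofPaths (Sides.single_mem_normalSpace _ _ hq _)] at h2
  exact Finsupp.single_left_injective one_ne_zero h2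

theorem isNormalRep_iff (a : LeavittPathAlgebra K o) (f : FreeAlg K H) :
    IsNormalRep K o a f ↔ f = pathFree H K (coords K o a) := by
  rw [IsNormalRep, Enumeration.nodSpan_eq]
  constructor
  · rintro ⟨⟨m, hm, rfl⟩, h⟩
    rw [← h]
    exact congrArg (pathFree H K) (coords_ofPaths hm).symm
  · rintro rfl
    exact ⟨⟨_, coords_mem a, rfl⟩, ofPaths_coords a⟩

theorem normalForm_eq (a : LeavittPathAlgebra K o) :
    normalForm K o a = pathFree H K (coords K o a) := by
  have h : ∃ f, IsNormalRep K o a f := ⟨_, (isNormalRep_iff a _).2 rfl⟩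
  rw [normalForm, dif_pos h]
  exact (isNormalRep_iff a _).1 h.choose_spec

/-- Injectivity of `pathWord` on normal paths excludes cancellation when coordinates are turned into
words. -/
theorem maxLength_eq (a : LeavittPathAlgebra K o) :
    maxLength K o a = (coords K o a).support.sup fun q => (q.1.length : WithBot ℕ) := by
  classical
  rw [maxLength, supp, normalForm_eq, coeff_pathFree,
    Finsupp.mapDomain_support_of_injOn _ ((pathWord_injOn o).mono fun q hq =>
      isNormal_of_mem_support hq), Finset.sup_image]
  simp only [Function.comp_def, pathLength_pathWord]

theorem maxLength_eq_bot_iff (a : LeavittPathAlgebra K o) : maxLength K o a = ⊥ ↔ a = 0 := by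
  rw [maxLength_eq, Finset.sup_eq_bot_iff]
  constructor
  · intro h
    apply coords_injective
    rw [map_zero, ← Finsupp.support_eq_empty, Finset.eq_empty_iff_forall_notMem]
    exact fun q hq => WithBot.coe_ne_bot (h q hq)
  · rintro rfl; simp

theorem maxLength_sub_le (a b : LeavittPathAlgebra K o) :
    maxLength K o (a - b) ≤ max (maxLength K o a) (maxLength K o b) := by
  classical
  simp only [maxLength_eq, map_sub]
  refine (Finset.sup_mono Finsupp.support_sub).trans ?_
  rw [Finset.sup_union]

/-- The support of a nonzero element contains a path of maximal length. -/
theorem exists_mem_support_of_ne_zero {a : LeavittPathAlgebra K o} (ha : a ≠ 0) :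
    ∃ p ∈ (coords K o a).support, maxLength K o a = p.1.length ∧
      ∀ q ∈ (coords K o a).support, q.1.length ≤ p.1.length := by
  have hne : (coords K o a).support.Nonempty := by
    rw [Finset.nonempty_iff_ne_empty, Ne, Finsupp.support_eq_empty]
    exact fun h => ha (coords_injective (h.trans (map_zero _).symm))
  obtain ⟨p, hp, hmax⟩ := Finset.exists_max_image _ (fun q : ArcPath V E => q.1.length) hne
  refine ⟨p, hp, ?_, hmax⟩
  rw [maxLength_eq]
  exact le_antisymm (Finset.sup_le fun q hq => by exact_mod_cast hmax q hq)
    (Finset.le_sup (f := fun q : ArcPath V E => (q.1.length : WithBot ℕ)) hp)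

/-- Right multiplication by a vertex filters the basis of normal paths by their final vertex. -/
theorem snd_eq_of_mem_support {a : LeavittPathAlgebra K o} {e : V} (ha : a * vertex K o e = a)
    {p : ArcPath V E} (hp : p ∈ (coords K o a).support) : p.2 = e := by
  classical
  have key : ∀ m ∈ o.sides.normalSpace K,
      ofPaths K o m * vertex K o e = ofPaths K o (m.filter fun q => q.2 = e) := by
    intro m hm
    induction hm using Sides.normalSpace_induction with
    | zero => rw [Finsupp.filter_zero]; simp
    | add m n _ _ h1 h2 => simp only [map_add, Finsupp.filter_add, add_mul, h1, h2]
    | smul c m _ h => simp only [map_smul, Finsupp.filter_smul, smul_mul_assoc, h]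
    | single l v hl =>
      by_cases h : v = e
      · subst h
        rw [Finsupp.filter_single_of_pos (fun q : ArcPath V E => q.2 = v) rfl,
          ofPaths_mul_vertex hl]
      · rw [Finsupp.filter_single_of_neg (fun q : ArcPath V E => q.2 = e) h,
          ← ofPaths_mul_vertex hl, mul_assoc, vertex_mul_vertex, if_neg h]
        simp
  have hmem : (coords K o a).filter (fun q => q.2 = e) ∈ o.sides.normalSpace K :=
    by
    refine (Finsupp.mem_supported K _).2 fun q hq => ?_
    rw [Finset.mem_coe, Finsupp.support_filter] at hq
    exact isNormal_of_mem_support (Finset.mem_of_mem_filter q hq)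
  have h1 := key _ (coords_mem a)
  rw [ofPaths_coords, ha] at h1
  have h2 := coords_ofPaths hmem
  rw [← h1] at h2
  rw [h2, Finsupp.support_filter, Finset.mem_filter] at hp
  exact hp.2

theorem vact_coords {a : LeavittPathAlgebra K o} {e : V} (ha : vertex K o e * a = a) :
    o.sides.vact K e (coords K o a) = coords K o a := by
  conv_rhs => rw [← ha, vertex, coords_mk_mul, o.freeAct_toFree K]
  rfl

theorem start_eq_of_mem_support {a : LeavittPathAlgebra K o} {e : V} (ha : vertex K o e * a = a)
    {q : ArcPath V E} (hq : q ∈ (coords K o a).support) : o.sides.start q.1 q.2 = e := by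
  classical
  have key : ∀ m : PathSpace K V E,
      o.sides.vact K e m = m.filter fun q => o.sides.start q.1 q.2 = e := by
    intro m
    induction m using Finsupp.induction_linear with
    | zero => rw [Finsupp.filter_zero]; simp
    | add m n h1 h2 => simp only [map_add, Finsupp.filter_add, h1, h2]
    | single q c =>
      by_cases h : o.sides.start q.1 q.2 = e
      · rw [Finsupp.filter_single_of_pos (fun q : ArcPath V E => o.sides.start q.1 q.2 = e) h]
        simp [Sides.vact, h]
      · rw [Finsupp.filter_single_of_neg (fun q : ArcPath V E => o.sides.start q.1 q.2 = e) h]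
        simp [Sides.vact, h]
  rw [← vact_coords ha, key, Finsupp.support_filter, Finset.mem_filter] at hq
  exact hq.2

/-- `pathMul` ignores final vertices. This is correct here because all paths of `a` end at `e` and
`vact` at `e` fixes the coordinates of `b`. -/
theorem coords_mul {a b : LeavittPathAlgebra K o} {e : V} (ha : a * vertex K o e = a)
    (hb : vertex K o e * b = b) :
    coords K o (a * b) = o.sides.pathMul (coords K o a) (coords K o b) := by
  conv_lhs => rw [← ofPaths_coords a, ofPaths, LinearMap.comp_apply, coords_mk_mul, pathFree,
    Finsupp.linearCombination_apply, Finsupp.sum, map_sum, LinearMap.sum_apply]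
  refine Finset.sum_congr rfl fun p hp => ?_
  have h1 := isNormal_of_mem_support hp
  have h2 := snd_eq_of_mem_support ha hp
  obtain ⟨l, v⟩ := p
  simp only at h2
  subst h2
  rw [map_smul, LinearMap.smul_apply, o.freeAct_pathWord K h1, vact_coords hb]

theorem maxLength_mul (hLV : H.ConditionLV) {a b : LeavittPathAlgebra K o} {e : V}
    (ha : a * vertex K o e = a) (hb : vertex K o e * b = b) :
    maxLength K o (a * b) = maxLength K o a + maxLength K o b := by
  by_cases ha0 : a = 0
  · rw [ha0, zero_mul, (maxLength_eq_bot_iff 0).2 rfl, WithBot.bot_add]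
  by_cases hb0 : b = 0
  · rw [hb0, mul_zero, (maxLength_eq_bot_iff 0).2 rfl, WithBot.add_bot]
  obtain ⟨p, hp, hpa, hpmax⟩ := exists_mem_support_of_ne_zero ha0
  obtain ⟨q, hq, hqb, hqmax⟩ := exists_mem_support_of_ne_zero hb0
  have hA : o.sides.EndsAt e p.1.length (coords K o a) := fun p' hp' =>
    ⟨isNormal_of_mem_support hp', snd_eq_of_mem_support ha hp', hpmax p' hp'⟩
  have hB : o.sides.StartsAt e q.1.length (coords K o b) := fun q' hq' =>
    ⟨isNormal_of_mem_support hq', start_eq_of_mem_support hb hq', hqmax q' hq'⟩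
  have hdim : ∀ h c, 2 ≤ o.sides.dim h c := by
    rintro h (_ | _)
    exacts [(hLV h).2, (hLV h).1]
  obtain ⟨r, hr, hr0⟩ := Sides.exists_pathMul_apply_ne_zero hdim hA hB hp rfl hq rfl
  rw [hpa, hqb, maxLength_eq, coords_mul ha hb]
  -- Rewriting never lengthens a word, which gives `≤`; the surviving path `r` gives `≥`.
  refine le_antisymm (Finset.sup_le fun r' hr' => ?_) ?_
  · have := (Finsupp.mem_supported K _).1
      (Sides.pathMul_mem_lengthLE (G := o.sides) hA.mem_lengthLE hB.mem_lengthLE) hr'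
    exact_mod_cast this
  · have := Finset.le_sup (f := fun q : ArcPath V E => (q.1.length : WithBot ℕ))
      (Finsupp.mem_support_iff.2 hr0)
    rw [hr] at this
    exact_mod_cast this

theorem coords_vertex (v : V) : coords K o (vertex K o v) = Finsupp.single ([], v) 1 := by
  rw [← ofPaths_nil, coords_ofPaths]
  exact Sides.single_mem_normalSpace o.sides K (q := (([], v) : ArcPath V E)) trivial 1

theorem vertex_injective : Function.Injective (vertex K o) := by
  intro x y h
  have h1 := congrArg (coords K o) h
  rw [coords_vertex, coords_vertex] at h1
  simpa using Finsupp.single_left_injective one_ne_zero h1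

theorem isRingWithEnoughIdempotents : IsRingWithEnoughIdempotents (vertexSet K o) := by
  classical
  refine ⟨?_, ?_, ?_, ?_, ?_⟩
  · rintro _ ⟨v, rfl⟩ h
    have h1 := congrArg (coords K o) h
    change coords K o (vertex K o v) = _ at h1
    rw [coords_vertex, map_zero] at h1
    simp at h1
  · rintro _ ⟨v, rfl⟩
    exact (vertex_mul_vertex v v).trans (if_pos rfl)
  · rintro _ ⟨v, rfl⟩ _ ⟨w, rfl⟩ h
    exact (vertex_mul_vertex v w).trans (if_neg fun hvw => h (by rw [hvw]))
  · rintro e ⟨F, hF, rfl⟩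
    rw [Finset.sum_mul_sum]
    refine Finset.sum_congr rfl fun f hf => ?_
    obtain ⟨v, rfl⟩ := hF hf
    rw [Finset.sum_eq_single_of_mem _ hf]
    · exact (vertex_mul_vertex v v).trans (if_pos rfl)
    · intro g hg hne
      obtain ⟨w, rfl⟩ := hF hg
      exact (vertex_mul_vertex v w).trans (if_neg fun hvw => hne (by rw [hvw]))
  · intro S
    -- A local unit for `S` is the sum of all initial and final vertices of the paths in the
    -- supports of its elements.
    let F : Finset V := S.biUnion fun a => (coords K o a).support.image (fun q => q.2) ∪
      (coords K o a).support.image fun q => o.sides.start q.1 q.2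
    refine ⟨∑ v ∈ F, vertex K o v, ⟨F.image (vertex K o), ?_, ?_⟩, fun a ha => ?_⟩
    · rw [Finset.coe_image]
      rintro _ ⟨v, -, rfl⟩
      exact ⟨v, rfl⟩
    · exact (Finset.sum_image (f := fun x => x) fun x _ y _ h => vertex_injective h).symm
    · have hsum : ∀ v ∈ F, (∑ u ∈ F, vertex K o u) * vertex K o v = vertex K o v ∧
          vertex K o v * ∑ u ∈ F, vertex K o u = vertex K o v := by
        intro v hv
        simp only [Finset.sum_mul, Finset.mul_sum, vertex_mul_vertex]
        simp [hv]
      have hmem : ∀ q ∈ (coords K o a).support, q.2 ∈ F ∧ o.sides.start q.1 q.2 ∈ F := by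
        intro q hq
        constructor
        · exact Finset.mem_biUnion.2 ⟨a, ha, Finset.mem_union_left _
            (Finset.mem_image_of_mem _ hq)⟩
        · exact Finset.mem_biUnion.2 ⟨a, ha, Finset.mem_union_right _
            (Finset.mem_image_of_mem (fun q : ArcPath V E => o.sides.start q.1 q.2) hq)⟩
      have hrep : a = ∑ q ∈ (coords K o a).support,
          coords K o a q • ofPaths K o (Finsupp.single q 1) := by
        conv_lhs => rw [← ofPaths_coords a, ← Finsupp.sum_single (coords K o a), Finsupp.sum,
          map_sum]
        refine Finset.sum_congr rfl fun q _ => ?_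
        rw [← map_smul, Finsupp.smul_single, smul_eq_mul, mul_one]
      generalize ∑ v ∈ F, vertex K o v = ε at hsum ⊢
      conv_rhs => rw [hrep]
      conv_lhs => rw [hrep]
      rw [Finset.mul_sum, Finset.sum_mul]
      refine Finset.sum_congr rfl fun q hq => ?_
      have hn := isNormal_of_mem_support hq
      rw [mul_smul_comm, smul_mul_assoc, ← vertex_start_mul_ofPaths hn, ← mul_assoc,
        (hsum _ (hmem q hq).2).1, vertex_start_mul_ofPaths hn, ← ofPaths_mul_vertex hn, mul_assoc,
        (hsum _ (hmem q hq).1).2]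

end LeavittPathAlgebra
end DirectedHypergraph

open DirectedHypergraph.LeavittPathAlgebra in
theorem mainTheorem5 {V : Type u} {E : Type v} (K : Type w) [Field K] (H : DirectedHypergraph V E)
    (o : H.Enumeration) (hLV : H.ConditionLV) :
    (∀ a : DirectedHypergraph.LeavittPathAlgebra K o,
        ∃! f : DirectedHypergraph.FreeAlg K H, DirectedHypergraph.LeavittPathAlgebra.IsNormalRep K o a f) ∧
      (∀ x y : V,
        DirectedHypergraph.LeavittPathAlgebra.mk K o ((DirectedHypergraph.Letter.vert x).toFree K) =
          DirectedHypergraph.LeavittPathAlgebra.mk K o ((DirectedHypergraph.Letter.vert y).toFree K) → x = y) ∧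
      IsLocalValuation (DirectedHypergraph.LeavittPathAlgebra.vertexSet K o)
        (DirectedHypergraph.LeavittPathAlgebra.maxLength K o) := by
  refine ⟨fun a => ⟨_, (isNormalRep_iff a _).2 rfl, fun f hf => (isNormalRep_iff a f).1 hf⟩,
    fun x y h => vertex_injective (K := K) (o := o) h, isRingWithEnoughIdempotents,
    maxLength_eq_bot_iff, maxLength_sub_le, ?_⟩
  rintro _ ⟨e, rfl⟩ _ ⟨a, rfl⟩ _ ⟨b, rfl⟩
  classical
  -- Idempotency turns membership in Re and eR into being fixed by e on the right and on the left.
  have he : vertex K o e * vertex K o e = vertex K o e := (vertex_mul_vertex e e).trans (if_pos rfl)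
  refine maxLength_mul hLV (e := e) ?_ ?_
  · change a * vertex K o e * vertex K o e = a * vertex K o e
    rw [mul_assoc, he]
  · change vertex K o e * (vertex K o e * b) = vertex K o e * b
    rw [← mul_assoc, he]
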